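/- Let $S_\infty$ be the group of permutations of $\mathbb{Z}_{>0}$ with all but finitely many points fixed, and let $s_k\in S_\infty$ be the transposition exchanging $k$ and $k+1$. An RC-graph of $w\in S_\infty$ is a finite subset $D\subset\mathbb{Z}_{>0}\times\mathbb{Z}_{>0}$ such that reading the cells $(i,j)\in D$ row by row, with $i$ increasing and, within each row, $j$ decreasing, the word formed by the $s_{i+j-1}$ is a reduced word for $w$, i.e. its product (as a composition of maps, the rightmost factor acting first) is $w$ and it has the minimal possible length. A simple ladder move (a ladder move of order $0$) replaces an RC-graph $D$ of $w$ by the RC-graph $D'=(D\setminus\{(i,j)\})\cup\{(i-1,j+1)\}$ of $w$, where $i\ge 2$, $(i,j)\in D$ and $(i,j+1),(i-1,j),(i-1,j+1)\notin D$. Two RC-graphs of $w$ are connected by simple ladder moves if one can be obtained from the other by a finite (possibly empty) sequence of simple ladder moves and inverses of simple ladder moves. The permutation $w$ avoids $1432$ if there are no positions $a_1<a_2<a_3<a_4$ with $w(a_1)<w(a_4)<w(a_3)<w(a_2)$. **Theorem.** For $w\in S_\infty$ the following are equivalent: 1. any two RC-graphs of $w$ are connected by simple ladder moves; 2. $w$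 avoids $1432$. -/

import Mathlib

/-- The simple transposition `s_k`, exchanging `k` and `k + 1`, as a permutation of `ℤ_{>0}`. -/
def simpleTransposition (k : ℕ+) : Equiv.Perm ℕ+ :=
  Equiv.swap k (k + 1)

/-- The order in which the cells `(row, column)` of the grid `ℤ_{>0} × ℤ_{>0}` are read:
rows from top to bottom, and each row from right to left. -/
def ReadBefore (p q : ℕ+ × ℕ+) : Prop :=
  p.1 < q.1 ∨ (p.1 = q.1 ∧ q.2 ≤ p.2)

instance : DecidableRel ReadBefore := fun p q =>
  inferInstanceAs (Decidable (p.1 < q.1 ∨ (p.1 = q.1 ∧ q.2 ≤ p.2)))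

instance : IsTrans (ℕ+ × ℕ+) ReadBefore where
  trans := by
    rintro a b c (h | ⟨h, h'⟩) (k | ⟨k, k'⟩)
    · exact Or.inl (h.trans k)
    · exact Or.inl (k ▸ h)
    · exact Or.inl (h ▸ k)
    · exact Or.inr ⟨h.trans k, k'.trans h'⟩

instance : Std.Antisymm ReadBefore where
  antisymm := by
    rintro ⟨a, a'⟩ ⟨b, b'⟩ (h | ⟨h, h'⟩) (k | ⟨k, k'⟩)
    · exact absurd (h.trans k) (lt_irrefl _)
    · exact absurd (k ▸ h) (lt_irrefl _)
    · exact absurd (h ▸ k) (lt_irrefl _)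
    · exact Prod.ext h (le_antisymm k' h')

instance : Std.Total ReadBefore where
  total := by
    intro a b
    rcases lt_trichotomy a.1 b.1 with h | h | h
    · exact Or.inl (Or.inl h)
    · rcases le_total b.2 a.2 with k | k
      · exact Or.inl (Or.inr ⟨h, k⟩)
      · exact Or.inr (Or.inr ⟨h.symm, k⟩)
    · exact Or.inr (Or.inl h)

/-- The word of a finite set `D` of cells: the indices `i + j - 1` of its cells `(i, j)`,
listed in reading order. (Here `i + j ≥ 2`, so the subtraction is the true one.) -/
def readingWord (D : Finset (ℕ+ × ℕ+)) : List ℕ+ :=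
  (D.sort ReadBefore).map fun p => p.1 + p.2 - 1

/-- The product `s_{k_1} s_{k_2} ⋯ s_{k_l}` of a word `k_1 k_2 … k_l`. -/
def wordProd (l : List ℕ+) : Equiv.Perm ℕ+ :=
  (l.map simpleTransposition).prod

/-- `l` is a reduced word for `w`: its product is `w`, and no word with product `w` is shorter. -/
def IsReducedWord (w : Equiv.Perm ℕ+) (l : List ℕ+) : Prop :=
  wordProd l = w ∧ ∀ l' : List ℕ+, wordProd l' = w → l.length ≤ l'.length

/-- The set `RC(w)` of RC-graphs of `w`. -/
def RCGraph (w : Equiv.Perm ℕ+) : Type :=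
  {D : Finset (ℕ+ × ℕ+) // IsReducedWord w (readingWord D)}

/-- `D'` arises from `D` by a ladder move of order `k` at a crossing `(i, j)`; the new crossing is
`(r, j + 1)`, where `r = i - k - 1`, so that the rows `i'` with `i - k ≤ i' < i` are
those with `r < i' < i`. -/
def IsLadderMove (k : ℕ) (D D' : Finset (ℕ+ × ℕ+)) : Prop :=
  ∃ i j r : ℕ+, (i : ℕ) = (r : ℕ) + k + 1 ∧
    (i, j) ∈ D ∧ (i, j + 1) ∉ D ∧ (r, j) ∉ D ∧ (r, j + 1) ∉ D ∧
    (∀ i' : ℕ+, r < i' → i' < i → (i', j) ∈ D ∧ (i', j + 1) ∈ D) ∧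
    D' = insert (r, j + 1) (D.erase (i, j))

/-- A simple ladder move between RC-graphs of `w`: a ladder move of order `0`. -/
def SimpleLadderMove {w : Equiv.Perm ℕ+} (D D' : RCGraph w) : Prop :=
  IsLadderMove 0 D.1 D'.1

/-- `w` contains the pattern `u`: some `a_1 < ⋯ < a_k` is an occurrence of `u` in `w`. -/
def ContainsPattern {k : ℕ} (u : Equiv.Perm (Fin k)) (w : Equiv.Perm ℕ+) : Prop :=
  ∃ a : Fin k → ℕ+, StrictMono a ∧ ∀ i j : Fin k, i < j → (w (a i) < w (a j) ↔ u i < u j)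

/-- The permutation `1432`; since `Fin 4 = {0, 1, 2, 3}`, its one-line notation
reads `0, 3, 2, 1` here. -/
def perm1432 : Equiv.Perm (Fin 4) :=
  Equiv.swap 1 3

theorem perm1432_oneLine : (perm1432 : Fin 4 → Fin 4) = ![0, 3, 2, 1] := by
  decide

/-! ### Inversions and reduced words -/

/-! Both directions peel off the first row. If `p = w 1`, then `w = rowCycle p * shiftPerm v`, where
`rowCycle p` is the product of a left-justified row with crossings in the columns below `p` and `v`
records the relative order of the remaining values. Prepending that row to an RC-graph of `v` gives
one of `w`, since each letter of the row creates an inversion.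

If `w` contains `1432`, an invariant separates two RC-graphs. A simple ladder move keeps the letter
of the moved crossing and carries it only past letters at distance at least 2, so for every `k` the
subword in the letters `k`, `k + 1` is unchanged (`IsLadderMove.adjacentSubword_eq`). An induction
on the size of `w` produces RC-graphs with different subwords (`hasDistinctAdjacentSubwords`). The
essential case is a pattern using position 1 whose two values `w d = q` and `w c = q + 1` are
consecutive. The RC-graph with all rows left-justified then has `q + 1` before the first `q`
(`exists_bottom`), while an RC-graph whose first row is that of `s_q w` with a crossing added in
column `q` starts with `q`. Other patterns are reduced to a smaller gap `w c - w d` or to a smaller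
permutation.

If `w` avoids `1432`, every RC-graph is linked to one whose first row is left-justified
(`exists_linked_addRow_Iio`). The lower rows form an RC-graph of a permutation that again avoids
`1432`, so by induction the second row may be taken left-justified. Avoidance then forces the gap of
the second row to lie left of every extra crossing of the first row (`le_of_not_containsPattern`),
so the leftmost extra crossing can descend by an inverse simple ladder move. Repeating this empties
the first row of extra crossings. Two RC-graphs with the same left-justified first row have lower
parts for the same permutation, and induction links those. -/

theorem simpleTransposition_apply (k x : ℕ+) :
    simpleTransposition k x = if x = k then k + 1 else if x = k + 1 then k else x := by
  simp [simpleTransposition, Equiv.swap_apply_def]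

theorem simpleTransposition_self (k : ℕ+) : simpleTransposition k k = k + 1 := by
  simp [simpleTransposition]

theorem simpleTransposition_succ (k : ℕ+) : simpleTransposition k (k + 1) = k := by
  simp [simpleTransposition]

theorem simpleTransposition_of_ne {k x : ℕ+} (h : x ≠ k) (h' : x ≠ k + 1) :
    simpleTransposition k x = x := by
  simp [simpleTransposition_apply, h, h']

theorem simpleTransposition_mul_self (k : ℕ+) :
    simpleTransposition k * simpleTransposition k = 1 := by
  simp [simpleTransposition]

theorem simpleTransposition_mul_cancel (k : ℕ+) (w : Equiv.Perm ℕ+) :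
    simpleTransposition k * (simpleTransposition k * w) = w := by
  rw [← mul_assoc, simpleTransposition_mul_self, one_mul]

theorem simpleTransposition_inv (k : ℕ+) :
    (simpleTransposition k)⁻¹ = simpleTransposition k := by
  simp [simpleTransposition]

theorem perm_apply_inv (w : Equiv.Perm ℕ+) (x : ℕ+) : w (w⁻¹ x) = x :=
  w.apply_symm_apply x

theorem perm_inv_eq_of_apply_eq {w : Equiv.Perm ℕ+} {x y : ℕ+} (h : w x = y) : w⁻¹ y = x :=
  Equiv.Perm.inv_eq_iff_eq.mpr h.symm

theorem simpleTransposition_lt_iff (k x y : ℕ+) :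
    simpleTransposition k x < simpleTransposition k y ↔
      (x < y ∧ ¬ (x = k ∧ y = k + 1)) ∨ (x = k + 1 ∧ y = k) := by
  simp only [simpleTransposition_apply]
  split_ifs <;> pnat_to_nat <;> lia

theorem simpleTransposition_mul_inv_apply (k : ℕ+) (w : Equiv.Perm ℕ+) (x : ℕ+) :
    (simpleTransposition k * w)⁻¹ x = w⁻¹ (simpleTransposition k x) := by
  rw [mul_inv_rev, simpleTransposition_inv, Equiv.Perm.mul_apply]

/-- The inversions of a permutation of `ℤ_{>0}`, as pairs of positions. -/
def inversions (w : Equiv.Perm ℕ+) : Set (ℕ+ × ℕ+) :=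
  {p | p.1 < p.2 ∧ w p.2 < w p.1}

theorem mem_inversions {w : Equiv.Perm ℕ+} {a b : ℕ+} :
    (a, b) ∈ inversions w ↔ a < b ∧ w b < w a := Iff.rfl

theorem inversions_one : inversions 1 = ∅ := by
  ext ⟨a, b⟩
  simp only [mem_inversions, Equiv.Perm.one_apply, Set.mem_empty_iff_false, iff_false]
  exact fun h => lt_asymm h.1 h.2

theorem inversions_simpleTransposition_mul {w : Equiv.Perm ℕ+} {k : ℕ+}
    (h : w⁻¹ k < w⁻¹ (k + 1)) :
    inversions (simpleTransposition k * w) = insert (w⁻¹ k, w⁻¹ (k + 1)) (inversions w) := by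
  ext ⟨a, b⟩
  simp only [mem_inversions, Equiv.Perm.mul_apply, simpleTransposition_lt_iff,
    Set.mem_insert_iff, Prod.mk.injEq, Equiv.Perm.eq_inv_iff_eq]
  constructor
  · rintro ⟨hab, ⟨h1, -⟩ | ⟨h1, h2⟩⟩
    · exact Or.inr ⟨hab, h1⟩
    · exact Or.inl ⟨h2, h1⟩
  · rintro (⟨h1, h2⟩ | ⟨hab, h1⟩)
    · refine ⟨?_, Or.inr ⟨h2, h1⟩⟩
      rwa [perm_inv_eq_of_apply_eq h1, perm_inv_eq_of_apply_eq h2] at h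
    · refine ⟨hab, Or.inl ⟨h1, ?_⟩⟩
      rintro ⟨h2, h3⟩
      rw [perm_inv_eq_of_apply_eq h2, perm_inv_eq_of_apply_eq h3] at h
      exact lt_asymm h hab

theorem notMem_inversions {w : Equiv.Perm ℕ+} {k : ℕ+} :
    (w⁻¹ k, w⁻¹ (k + 1)) ∉ inversions w := by
  simp only [mem_inversions, perm_apply_inv, not_and, not_lt]
  intro _
  exact (PNat.lt_add_right k 1).le

theorem inv_lt_or_gt (w : Equiv.Perm ℕ+) (k : ℕ+) :
    w⁻¹ k < w⁻¹ (k + 1) ∨ w⁻¹ (k + 1) < w⁻¹ k := by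
  apply lt_or_gt_of_ne
  intro h
  have := w⁻¹.injective h
  exact absurd this (PNat.lt_add_right k 1).ne

theorem simpleTransposition_mul_descent {w : Equiv.Perm ℕ+} {k : ℕ+}
    (h : w⁻¹ (k + 1) < w⁻¹ k) :
    (simpleTransposition k * w)⁻¹ k < (simpleTransposition k * w)⁻¹ (k + 1) := by
  rwa [simpleTransposition_mul_inv_apply, simpleTransposition_mul_inv_apply,
    simpleTransposition_self, simpleTransposition_succ]

theorem inversions_eq_of_descent {w : Equiv.Perm ℕ+} {k : ℕ+}
    (h : w⁻¹ (k + 1) < w⁻¹ k) :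
    inversions w = insert (w⁻¹ (k + 1), w⁻¹ k) (inversions (simpleTransposition k * w)) := by
  have := inversions_simpleTransposition_mul (simpleTransposition_mul_descent h)
  rwa [simpleTransposition_mul_cancel, simpleTransposition_mul_inv_apply,
    simpleTransposition_mul_inv_apply, simpleTransposition_self, simpleTransposition_succ] at this

theorem ncard_inversions_of_ascent {w : Equiv.Perm ℕ+} {k : ℕ+}
    (h : w⁻¹ k < w⁻¹ (k + 1)) (hf : (inversions w).Finite) :
    (inversions (simpleTransposition k * w)).ncard = (inversions w).ncard + 1 := by
  rw [inversions_simpleTransposition_mul h, Set.ncard_insert_of_notMem notMem_inversions hf]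

theorem finite_inversions_simpleTransposition_mul {w : Equiv.Perm ℕ+} (k : ℕ+)
    (hf : (inversions w).Finite) : (inversions (simpleTransposition k * w)).Finite := by
  rcases inv_lt_or_gt w k with h | h
  · rw [inversions_simpleTransposition_mul h]
    exact hf.insert _
  · rw [inversions_eq_of_descent h] at hf
    exact hf.subset (Set.subset_insert _ _)

/-! ### Reduced length as the number of inversions. -/

theorem wordProd_nil : wordProd [] = 1 := rfl

theorem wordProd_cons (k : ℕ+) (l : List ℕ+) :
    wordProd (k :: l) = simpleTransposition k * wordProd l := by
  simp [wordProd]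

theorem wordProd_append (l l' : List ℕ+) :
    wordProd (l ++ l') = wordProd l * wordProd l' := by
  simp [wordProd]

theorem finite_inversions_wordProd (l : List ℕ+) : (inversions (wordProd l)).Finite := by
  induction l with
  | nil => simp [wordProd_nil, inversions_one]
  | cons k l ih =>
    rw [wordProd_cons]
    exact finite_inversions_simpleTransposition_mul k ih

theorem ncard_inversions_le_length (l : List ℕ+) :
    (inversions (wordProd l)).ncard ≤ l.length := by
  induction l with
  | nil => simp [wordProd_nil, inversions_one]
  | cons k l ih =>
    rw [wordProd_cons, List.length_cons]
    rcases inv_lt_or_gt (wordProd l) k with h | h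
    · rw [ncard_inversions_of_ascent h (finite_inversions_wordProd l)]
      omega
    · rw [inversions_eq_of_descent h] at ih
      have := Set.ncard_le_ncard (Set.subset_insert ((wordProd l)⁻¹ (k + 1), (wordProd l)⁻¹ k)
        (inversions (simpleTransposition k * wordProd l)))
        ((finite_inversions_simpleTransposition_mul k (finite_inversions_wordProd l)).insert _)
      omega

/-- Every letter of the word, read from the right, creates a new inversion. -/
def InversionCreating : List ℕ+ → Prop
  | [] => True
  | k :: l => InversionCreating l ∧ (wordProd l)⁻¹ k < (wordProd l)⁻¹ (k + 1)

theorem InversionCreating.ncard_inversions {l : List ℕ+} (h : InversionCreating l) :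
    (inversions (wordProd l)).ncard = l.length := by
  induction l with
  | nil => simp [wordProd_nil, inversions_one]
  | cons k l ih =>
    rw [wordProd_cons, List.length_cons,
      ncard_inversions_of_ascent h.2 (finite_inversions_wordProd l), ih h.1]

theorem inversionCreating_of_ncard {l : List ℕ+}
    (h : (inversions (wordProd l)).ncard = l.length) : InversionCreating l := by
  induction l with
  | nil => trivial
  | cons k l ih =>
    rw [wordProd_cons, List.length_cons] at h
    have hle := ncard_inversions_le_length l
    rcases inv_lt_or_gt (wordProd l) k with h' | h'
    · rw [ncard_inversions_of_ascent h' (finite_inversions_wordProd l)] at h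
      exact ⟨ih (by omega), h'⟩
    · have h2 := simpleTransposition_mul_descent h'
      have h3 := ncard_inversions_of_ascent h2
        (finite_inversions_simpleTransposition_mul k (finite_inversions_wordProd l))
      rw [simpleTransposition_mul_cancel] at h3
      omega

theorem exists_descent {w : Equiv.Perm ℕ+} (h : w ≠ 1) :
    ∃ k, w⁻¹ (k + 1) < w⁻¹ k := by
  by_contra! hc
  apply h
  have hm : StrictMono (w⁻¹ : Equiv.Perm ℕ+) := by
    apply strictMono_of_lt_add_one
    intro a _
    exact (inv_lt_or_gt w a).resolve_right (not_lt.mpr (hc a))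
  -- A well-order has no automorphism besides the identity.
  have := Subsingleton.elim (hm.orderIsoOfSurjective _ w⁻¹.surjective) (OrderIso.refl ℕ+)
  rw [← inv_eq_one]
  ext x
  have := DFunLike.congr_fun this x
  simpa using congrArg PNat.val this

theorem exists_inversionCreating_aux (n : ℕ) : ∀ w : Equiv.Perm ℕ+, (inversions w).Finite →
    (inversions w).ncard = n → ∃ l, wordProd l = w ∧ InversionCreating l := by
  induction n with
  | zero =>
    intro w hf hn
    rw [Set.ncard_eq_zero hf] at hn
    refine ⟨[], ?_, trivial⟩
    by_contra hw
    obtain ⟨k, hk⟩ := exists_descent (Ne.symm hw)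
    rw [inversions_eq_of_descent hk] at hn
    exact (Set.insert_nonempty _ _).ne_empty hn
  | succ n ih =>
    intro w hf hn
    obtain ⟨k, hk⟩ := exists_descent (w := w) (by
      rintro rfl
      simp [inversions_one] at hn)
    have hk' := simpleTransposition_mul_descent hk
    have hf' := finite_inversions_simpleTransposition_mul k hf
    have h3 := ncard_inversions_of_ascent hk' hf'
    rw [simpleTransposition_mul_cancel] at h3
    obtain ⟨l, hl, hl'⟩ := ih _ hf' (by omega)
    refine ⟨k :: l, ?_, hl', ?_⟩
    · rw [wordProd_cons, hl, simpleTransposition_mul_cancel]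
    · rwa [hl]

theorem exists_inversionCreating {w : Equiv.Perm ℕ+} (hf : (inversions w).Finite) :
    ∃ l, wordProd l = w ∧ InversionCreating l :=
  exists_inversionCreating_aux _ w hf rfl

theorem isReducedWord_iff {w : Equiv.Perm ℕ+} {l : List ℕ+} :
    IsReducedWord w l ↔ wordProd l = w ∧ InversionCreating l := by
  constructor
  · rintro ⟨rfl, h⟩
    refine ⟨rfl, ?_⟩
    obtain ⟨l', h1, h2⟩ := exists_inversionCreating (finite_inversions_wordProd l)
    apply inversionCreating_of_ncard
    have := h l' h1
    have := h2.ncard_inversions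
    rw [h1] at this
    have := ncard_inversions_le_length l
    omega
  · rintro ⟨rfl, h⟩
    refine ⟨rfl, fun l' hl' => ?_⟩
    rw [← h.ncard_inversions, ← hl']
    exact ncard_inversions_le_length l'

theorem IsReducedWord.of_length_eq {w : Equiv.Perm ℕ+} {l l' : List ℕ+} (h : IsReducedWord w l)
    (hp : wordProd l' = w) (hl : l'.length = l.length) : IsReducedWord w l' :=
  ⟨hp, fun m hm => hl ▸ h.2 m hm⟩

theorem IsReducedWord.of_append {w : Equiv.Perm ℕ+} {l l' : List ℕ+}
    (h : IsReducedWord w (l ++ l')) : IsReducedWord (wordProd l') l' := by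
  refine ⟨rfl, fun m hm => ?_⟩
  have := h.2 (l ++ m) (by rw [wordProd_append, hm, ← wordProd_append, h.1])
  simpa using this

/-- Prepending a letter to a reduced word swaps two values and adds one inversion without destroying
any, because inversions are recorded by positions. This carries decreasing parts of patterns from a
suffix to `w`. -/
theorem IsReducedWord.inversions_subset {w : Equiv.Perm ℕ+} {l l' : List ℕ+}
    (h : IsReducedWord w (l ++ l')) : inversions (wordProd l') ⊆ inversions w := by
  rw [isReducedWord_iff] at h
  obtain ⟨rfl, h⟩ := h
  induction l with
  | nil => exact subset_rfl
  | cons k l ih =>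
    rw [List.cons_append] at h ⊢
    rw [wordProd_cons, inversions_simpleTransposition_mul h.2]
    exact (ih h.1).trans (Set.subset_insert _ _)

/-! ### Shifting permutations and words -/

theorem pnat_eq_one_or_eq_add_one (x : ℕ+) : x = 1 ∨ ∃ n, x = n + 1 := by
  by_cases h : x = 1
  · exact Or.inl h
  · obtain ⟨n, hn⟩ := PNat.exists_eq_succ_of_ne_one h
    exact Or.inr ⟨n, hn⟩

theorem pnat_add_one_ne_one (n : ℕ+) : n + 1 ≠ 1 :=
  (PNat.lt_add_left 1 n).ne'

/-- The permutation fixing `1` and sending `n + 1` to `v n + 1`. -/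
noncomputable def shiftPerm : Equiv.Perm ℕ+ →* Equiv.Perm ℕ+ :=
  Equiv.Perm.viaEmbeddingHom (addRightEmbedding 1)

theorem shiftPerm_apply_add_one (v : Equiv.Perm ℕ+) (n : ℕ+) :
    shiftPerm v (n + 1) = v n + 1 :=
  Equiv.Perm.viaEmbedding_apply v (addRightEmbedding 1) n

theorem shiftPerm_apply_one (v : Equiv.Perm ℕ+) : shiftPerm v 1 = 1 := by
  apply Equiv.Perm.viaEmbedding_apply_of_notMem
  rintro ⟨n, hn⟩
  exact pnat_add_one_ne_one n hn

theorem shiftPerm_injective : Function.Injective shiftPerm :=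
  Equiv.Perm.viaEmbeddingHom_injective _

theorem shiftPerm_simpleTransposition (k : ℕ+) :
    shiftPerm (simpleTransposition k) = simpleTransposition (k + 1) := by
  refine Equiv.ext fun x => ?_
  rcases pnat_eq_one_or_eq_add_one x with rfl | ⟨n, rfl⟩
  · rw [shiftPerm_apply_one, simpleTransposition_of_ne] <;> exact (pnat_add_one_ne_one _).symm
  · rw [shiftPerm_apply_add_one, simpleTransposition_apply, simpleTransposition_apply]
    split_ifs <;> pnat_to_nat <;> lia

theorem wordProd_map_add_one (l : List ℕ+) :
    wordProd (l.map (· + 1)) = shiftPerm (wordProd l) := by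
  induction l with
  | nil => simp [wordProd_nil]
  | cons k l ih =>
    rw [List.map_cons, wordProd_cons, wordProd_cons, map_mul, ih, shiftPerm_simpleTransposition]

theorem InversionCreating.map_add_one {l : List ℕ+} (h : InversionCreating l) :
    InversionCreating (l.map (· + 1)) := by
  induction l with
  | nil => trivial
  | cons k l ih =>
    refine ⟨ih h.1, ?_⟩
    rw [wordProd_map_add_one, ← map_inv, shiftPerm_apply_add_one, shiftPerm_apply_add_one]
    exact add_lt_add_left h.2 1

theorem exists_shiftPerm_eq {z : Equiv.Perm ℕ+} (hz : z 1 = 1) : ∃ v, shiftPerm v = z := by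
  -- Subtraction in `ℕ+` never goes below 1, so `y (n + 1) - 1` is meaningful only because `y` fixes
  -- 1 and hence `y (n + 1) > 1`.
  have key : ∀ y : Equiv.Perm ℕ+, y 1 = 1 → ∀ n : ℕ+, y (n + 1) - 1 + 1 = y (n + 1) := by
    intro y hy n
    apply PNat.sub_add_of_lt
    apply lt_of_le_of_ne (one_le)
    intro h
    exact pnat_add_one_ne_one n (y.injective (h.symm.trans hy.symm))
  have hz' : z⁻¹ 1 = 1 := perm_inv_eq_of_apply_eq hz
  refine ⟨⟨fun n => z (n + 1) - 1, fun n => z⁻¹ (n + 1) - 1, fun n => ?_, fun n => ?_⟩, ?_⟩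
  · apply add_right_cancel (b := 1)
    change z⁻¹ (z (n + 1) - 1 + 1) - 1 + 1 = n + 1
    rw [key z hz, perm_inv_eq_of_apply_eq rfl]
    exact PNat.sub_add_of_lt (PNat.lt_add_left 1 n)
  · apply add_right_cancel (b := 1)
    change z (z⁻¹ (n + 1) - 1 + 1) - 1 + 1 = n + 1
    rw [key _ hz', perm_apply_inv]
    exact PNat.sub_add_of_lt (PNat.lt_add_left 1 n)
  · refine Equiv.ext fun x => ?_
    rcases pnat_eq_one_or_eq_add_one x with rfl | ⟨n, rfl⟩
    · rw [shiftPerm_apply_one, hz]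
    · rw [shiftPerm_apply_add_one]
      exact key z hz n

/-! ### Rows -/

/-- The word contributed by a first row with crossings in the columns `U`. -/
def rowWord (U : Finset ℕ+) : List ℕ+ :=
  U.sort (· ≥ ·)

theorem mem_rowWord {U : Finset ℕ+} {k : ℕ+} : k ∈ rowWord U ↔ k ∈ U :=
  Finset.mem_sort _

theorem rowWord_empty : rowWord ∅ = [] :=
  Finset.sort_empty _

theorem rowWord_singleton (k : ℕ+) : rowWord {k} = [k] :=
  Finset.sort_singleton _ _

theorem rowWord_union {A B : Finset ℕ+} (h : ∀ a ∈ A, ∀ b ∈ B, b < a) :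
    rowWord (A ∪ B) = rowWord A ++ rowWord B := by
  have hn : (rowWord A ++ rowWord B).Nodup := by
    refine List.Nodup.append (Finset.sort_nodup _ _) (Finset.sort_nodup _ _) ?_
    intro x hx hx'
    exact lt_irrefl _ (h x (mem_rowWord.mp hx) x (mem_rowWord.mp hx'))
  have he : A ∪ B = (rowWord A ++ rowWord B).toFinset := by
    ext x
    simp [mem_rowWord]
  rw [rowWord, he, List.toFinset_sort _ hn, List.pairwise_append]
  refine ⟨Finset.pairwise_sort _ _, Finset.pairwise_sort _ _, fun a ha b hb => ?_⟩
  exact (h a (mem_rowWord.mp ha) b (mem_rowWord.mp hb)).le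

/-- The finite set of cells with first row `U`, followed by the rows of `D`. -/
def addRow (U : Finset ℕ+) (D : Finset (ℕ+ × ℕ+)) : Finset (ℕ+ × ℕ+) :=
  U.image (fun j => (1, j)) ∪ D.image (fun p => (p.1 + 1, p.2))

theorem one_mem_addRow {U : Finset ℕ+} {D : Finset (ℕ+ × ℕ+)} {j : ℕ+} :
    (1, j) ∈ addRow U D ↔ j ∈ U := by
  simp only [addRow, Finset.mem_union, Finset.mem_image, Prod.mk.injEq, true_and,
    exists_eq_right, or_iff_left_iff_imp]
  rintro ⟨p, -, hp, -⟩
  exact absurd hp (pnat_add_one_ne_one _)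

theorem add_one_mem_addRow {U : Finset ℕ+} {D : Finset (ℕ+ × ℕ+)} {i j : ℕ+} :
    (i + 1, j) ∈ addRow U D ↔ (i, j) ∈ D := by
  simp only [addRow, Finset.mem_union, Finset.mem_image, Prod.mk.injEq, add_left_inj]
  constructor
  · rintro (⟨_, _, h, _⟩ | ⟨p, hp, rfl, rfl⟩)
    · exact absurd h.symm (pnat_add_one_ne_one _)
    · exact hp
  · exact fun h => Or.inr ⟨_, h, rfl, rfl⟩

theorem addRow_ext {E : Finset (ℕ+ × ℕ+)} {U : Finset ℕ+} {D : Finset (ℕ+ × ℕ+)}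
    (h1 : ∀ j, (1, j) ∈ E ↔ j ∈ U) (h2 : ∀ i j, (i + 1, j) ∈ E ↔ (i, j) ∈ D) :
    E = addRow U D := by
  ext ⟨i, j⟩
  rcases pnat_eq_one_or_eq_add_one i with rfl | ⟨n, rfl⟩
  · rw [h1, one_mem_addRow]
  · rw [h2, add_one_mem_addRow]

theorem exists_eq_addRow (E : Finset (ℕ+ × ℕ+)) : ∃ U D, E = addRow U D := by
  have inj1 : Function.Injective (fun j : ℕ+ => ((1, j) : ℕ+ × ℕ+)) := fun a b h => by
    simpa using h
  have inj2 : Function.Injective (fun p : ℕ+ × ℕ+ => (p.1 + 1, p.2)) := fun a b h => by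
    simpa [Prod.ext_iff] using h
  refine ⟨E.preimage _ inj1.injOn, E.preimage _ inj2.injOn, addRow_ext ?_ ?_⟩ <;> simp

theorem readingWord_addRow (U : Finset ℕ+) (D : Finset (ℕ+ × ℕ+)) :
    readingWord (addRow U D) = rowWord U ++ (readingWord D).map (· + 1) := by
  have inj1 : Function.Injective (fun j : ℕ+ => ((1, j) : ℕ+ × ℕ+)) := fun a b h => by
    simpa using h
  have inj2 : Function.Injective (fun p : ℕ+ × ℕ+ => (p.1 + 1, p.2)) := fun a b h => by
    simpa [Prod.ext_iff] using h
  set l := (rowWord U).map (fun j => ((1, j) : ℕ+ × ℕ+)) ++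
    (D.sort ReadBefore).map (fun p => (p.1 + 1, p.2)) with hl
  have hn : l.Nodup := by
    refine List.Nodup.append ((Finset.sort_nodup _ _).map inj1)
      ((Finset.sort_nodup _ _).map inj2) ?_
    intro x hx hx'
    simp only [List.mem_map] at hx hx'
    obtain ⟨_, _, rfl⟩ := hx
    obtain ⟨p, _, hp⟩ := hx'
    exact pnat_add_one_ne_one p.1 (congrArg Prod.fst hp)
  have he : addRow U D = l.toFinset := by
    ext x
    simp [addRow, hl, mem_rowWord]
  have hs : (addRow U D).sort ReadBefore = l := by
    rw [he, List.toFinset_sort _ hn, hl, List.pairwise_append]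
    refine ⟨?_, ?_, ?_⟩
    · rw [List.pairwise_map]
      exact (Finset.pairwise_sort U _).imp fun h => Or.inr ⟨rfl, h⟩
    · rw [List.pairwise_map]
      refine (Finset.pairwise_sort D _).imp ?_
      rintro a b (h | ⟨h, h'⟩)
      · exact Or.inl (add_lt_add_left h 1)
      · exact Or.inr ⟨congrArg (· + 1) h, h'⟩
    · intro a ha b hb
      simp only [List.mem_map] at ha hb
      obtain ⟨_, _, rfl⟩ := ha
      obtain ⟨p, _, rfl⟩ := hb
      exact Or.inl (PNat.lt_add_left 1 p.1)
  rw [readingWord, hs, hl, List.map_append, List.map_map, List.map_map, readingWord, List.map_map]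
  congr 1
  · conv_rhs => rw [← List.map_id (rowWord U)]
    apply List.map_congr_left
    intro j _
    simp only [Function.comp, id]
    have := j.pos
    pnat_to_nat; lia
  · apply List.map_congr_left
    rintro ⟨i, j⟩ _
    simp only [Function.comp]
    pnat_to_nat; lia

theorem readingWord_empty : readingWord ∅ = [] := by
  simp [readingWord]

/-! ### Left-justified rows -/

/-- The product `s_{p - 1} ⋯ s_1` contributed by a left-justified row with `p - 1` crossings. -/
def rowCycle (p : ℕ+) : Equiv.Perm ℕ+ :=
  wordProd (rowWord (Finset.Iio p))

theorem rowWord_Iio_one : rowWord (Finset.Iio 1) = [] := by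
  have : Finset.Iio (1 : ℕ+) = ∅ := by
    ext x; simp
  rw [this, rowWord_empty]

theorem rowWord_Iio_add_one (p : ℕ+) :
    rowWord (Finset.Iio (p + 1)) = p :: rowWord (Finset.Iio p) := by
  have : Finset.Iio (p + 1) = {p} ∪ Finset.Iio p := by
    ext x
    simp only [Finset.mem_Iio, Finset.mem_union, Finset.mem_singleton]
    pnat_to_nat; lia
  rw [this, rowWord_union (by simp), rowWord_singleton]
  rfl

theorem rowCycle_one : rowCycle 1 = 1 := by
  rw [rowCycle, rowWord_Iio_one, wordProd_nil]

theorem rowCycle_add_one (p : ℕ+) :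
    rowCycle (p + 1) = simpleTransposition p * rowCycle p := by
  rw [rowCycle, rowWord_Iio_add_one, wordProd_cons, rowCycle]

theorem rowCycle_apply_one (p : ℕ+) : rowCycle p 1 = p := by
  induction p using PNat.recOn with
  | one => simp [rowCycle_one]
  | succ p ih =>
    rw [rowCycle_add_one, Equiv.Perm.mul_apply, ih, simpleTransposition_self]

theorem rowCycle_apply_add_one (p n : ℕ+) :
    rowCycle p (n + 1) = if n < p then n else n + 1 := by
  induction p using PNat.recOn with
  | one => simp [rowCycle_one]
  | succ p ih =>
    rw [rowCycle_add_one, Equiv.Perm.mul_apply, ih, simpleTransposition_apply]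
    split_ifs <;> pnat_to_nat <;> lia

theorem rowCycle_add_one_lt_iff (p m n : ℕ+) :
    rowCycle p (m + 1) < rowCycle p (n + 1) ↔ m < n := by
  rw [rowCycle_apply_add_one, rowCycle_apply_add_one]
  split_ifs <;> pnat_to_nat <;> lia

/-- When the letter `p` is prepended, the value `p` sits at position 1, hence before the value `p +
1`. -/
theorem inversionCreating_rowWord_Iio_append (p : ℕ+) {l : List ℕ+} (h : InversionCreating l) :
    InversionCreating (rowWord (Finset.Iio p) ++ l.map (· + 1)) := by
  induction p using PNat.recOn with
  | one =>
    rw [rowWord_Iio_one]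
    exact h.map_add_one
  | succ p ih =>
    rw [rowWord_Iio_add_one]
    refine ⟨ih, ?_⟩
    rw [List.append_eq]
    have h1 : wordProd (rowWord (Finset.Iio p) ++ l.map (· + 1)) 1 = p := by
      rw [wordProd_append, wordProd_map_add_one, Equiv.Perm.mul_apply, shiftPerm_apply_one]
      exact rowCycle_apply_one p
    rw [perm_inv_eq_of_apply_eq h1]
    refine lt_of_le_of_ne (one_le) fun h2 => ?_
    have h3 := perm_apply_inv (wordProd (rowWord (Finset.Iio p) ++ l.map (· + 1))) (p + 1)
    rw [← h2, h1] at h3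
    exact (PNat.lt_add_right p 1).ne h3

theorem isReducedWord_addRow_Iio {v : Equiv.Perm ℕ+} {D : Finset (ℕ+ × ℕ+)}
    (h : IsReducedWord v (readingWord D)) (p : ℕ+) :
    IsReducedWord (rowCycle p * shiftPerm v) (readingWord (addRow (Finset.Iio p) D)) := by
  rw [isReducedWord_iff] at h ⊢
  rw [readingWord_addRow, wordProd_append, wordProd_map_add_one, h.1]
  exact ⟨rfl, inversionCreating_rowWord_Iio_append p h.2⟩

theorem exists_eq_rowCycle_mul_shiftPerm (w : Equiv.Perm ℕ+) :
    ∃ v, w = rowCycle (w 1) * shiftPerm v := by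
  obtain ⟨v, hv⟩ := exists_shiftPerm_eq (z := (rowCycle (w 1))⁻¹ * w) (by
    rw [Equiv.Perm.mul_apply]
    exact perm_inv_eq_of_apply_eq (rowCycle_apply_one _))
  exact ⟨v, by rw [hv, mul_inv_cancel_left]⟩

/-! ### Simple ladder moves preserve the order of adjacent letters -/

/-- The subword of `l` formed by the letters `k` and `k + 1`. -/
def adjacentSubword (k : ℕ+) (l : List ℕ+) : List ℕ+ :=
  l.filter fun x => decide (x = k ∨ x = k + 1)

theorem adjacentSubword_append (k : ℕ+) (l l' : List ℕ+) :
    adjacentSubword k (l ++ l') = adjacentSubword k l ++ adjacentSubword k l' :=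
  List.filter_append _ _

theorem adjacentSubword_map_add_one (k : ℕ+) (l : List ℕ+) :
    adjacentSubword (k + 1) (l.map (· + 1)) = (adjacentSubword k l).map (· + 1) := by
  simp [adjacentSubword, List.filter_map, Function.comp_def]

theorem adjacentSubword_eq_nil {k : ℕ+} {l : List ℕ+} (h : ∀ x ∈ l, x < k) :
    adjacentSubword k l = [] := by
  rw [adjacentSubword, List.filter_eq_nil_iff]
  intro x hx
  have := h x hx
  simp only [decide_eq_true_eq]
  pnat_to_nat; lia

/-- The cells read between `(r, j + 1)` and `(r + 1, j)` lie in row `r` up to column `j` or in row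
`r + 1` beyond column `j`. With `(r, j)` and `(r + 1, j + 1)` empty, their letters differ from the
moved letter `r + j` by at least 2. -/
theorem IsLadderMove.readBefore_of_adjacent {D : Finset (ℕ+ × ℕ+)} {r j k : ℕ+} {a : ℕ+ × ℕ+}
    (h2 : (r + 1, j + 1) ∉ D) (h3 : (r, j) ∉ D) (ha : a ∈ D)
    (hne : a ≠ (r + 1, j)) (hP : r + 1 + j - 1 = k ∨ r + 1 + j - 1 = k + 1)
    (hP' : a.1 + a.2 - 1 = k ∨ a.1 + a.2 - 1 = k + 1) (hab : ReadBefore a (r + 1, j)) :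
    ReadBefore a (r, j + 1) := by
  obtain ⟨a1, a2⟩ := a
  have e1 : ¬ (a1 = r + 1 ∧ a2 = j + 1) := by rintro ⟨rfl, rfl⟩; exact h2 ha
  have e2 : ¬ (a1 = r ∧ a2 = j) := by rintro ⟨rfl, rfl⟩; exact h3 ha
  have e3 : ¬ (a1 = r + 1 ∧ a2 = j) := by rintro ⟨rfl, rfl⟩; exact hne rfl
  clear h2 h3 ha hne
  simp only [ReadBefore] at hab hP' ⊢
  pnat_to_nat; lia

theorem IsLadderMove.adjacentSubword_eq {D D' : Finset (ℕ+ × ℕ+)} (h : IsLadderMove 0 D D')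
    (k : ℕ+) : adjacentSubword k (readingWord D) = adjacentSubword k (readingWord D') := by
  obtain ⟨i, j, r, hi, h1, h2, h3, h4, -, rfl⟩ := h
  obtain rfl : i = r + 1 := by pnat_to_nat; lia
  set f : ℕ+ × ℕ+ → ℕ+ := fun p => p.1 + p.2 - 1 with hf
  set P : ℕ+ × ℕ+ → Bool := fun p => decide (f p = k ∨ f p = k + 1) with hPdef
  set g : ℕ+ × ℕ+ → ℕ+ × ℕ+ := fun x => if x = (r + 1, j) then (r, j + 1) else x with hg
  set D' := insert (r, j + 1) (D.erase (r + 1, j)) with hD'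
  have hfeq : f (r, j + 1) = f (r + 1, j) := by
    simp only [hf]
    pnat_to_nat; lia
  have hfg : ∀ x, f (g x) = f x := by
    intro x
    simp only [hg]
    split_ifs with hx
    · rw [hx, hfeq]
    · rfl
  have hne : ((r, j + 1) : ℕ+ × ℕ+) ≠ (r + 1, j) := fun hh =>
    (PNat.lt_add_right r 1).ne (congrArg Prod.fst hh)
  -- Two lists sorted by `ReadBefore` with the same elements coincide; `g` moves the one cell, keeps
  -- its letter, and respects the order on cells with letter `k` or `k + 1`.
  have key : ((D.sort ReadBefore).filter P).map g = (D'.sort ReadBefore).filter P := by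
    refine List.Perm.eq_of_pairwise' (r := ReadBefore) ?_
      ((Finset.pairwise_sort D' _).filter _) ?_
    · rw [List.pairwise_map]
      refine ((Finset.pairwise_sort D _).filter P).imp_of_mem ?_
      intro a b ha hb hab
      simp only [List.mem_filter, Finset.mem_sort, hPdef, decide_eq_true_eq] at ha hb
      by_cases ea : a = (r + 1, j)
      · by_cases eb : b = (r + 1, j)
        · exact Or.inr ⟨by rw [ea, eb], by rw [ea, eb]⟩
        · simp only [hg, if_pos ea, if_neg eb]
          left
          rw [ea] at hab
          rcases hab with hab | ⟨hab, -⟩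
          · exact (PNat.lt_add_right r 1).trans hab
          · exact hab ▸ PNat.lt_add_right r 1
      · by_cases eb : b = (r + 1, j)
        · simp only [hg, if_pos eb, if_neg ea]
          rw [eb] at hab hb
          exact IsLadderMove.readBefore_of_adjacent h2 h3 ha.1 ea hb.2 ha.2 hab
        · simpa only [hg, if_neg ea, if_neg eb] using hab
    · rw [List.perm_ext_iff_of_nodup]
      · rintro x
        simp only [List.mem_map, List.mem_filter, Finset.mem_sort]
        constructor
        · rintro ⟨y, ⟨hy, hPy⟩, rfl⟩
          refine ⟨?_, by simpa only [hPdef, hfg] using hPy⟩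
          simp only [hg]
          split_ifs with e
          · exact Finset.mem_insert_self _ _
          · exact Finset.mem_insert_of_mem (Finset.mem_erase.mpr ⟨e, hy⟩)
        · rintro ⟨hx, hPx⟩
          rcases Finset.mem_insert.mp hx with rfl | hx
          · exact ⟨(r + 1, j), ⟨h1, by simpa only [hPdef, hfeq] using hPx⟩, by simp [hg]⟩
          · rw [Finset.mem_erase] at hx
            exact ⟨x, ⟨hx.2, hPx⟩, by simp [hg, hx.1]⟩
      · refine List.Nodup.map_on ?_ ((Finset.sort_nodup _ _).filter _)
        intro a ha b hb hab
        simp only [List.mem_filter, Finset.mem_sort] at ha hb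
        simp only [hg] at hab
        split_ifs at hab with ea eb eb
        · rw [ea, eb]
        · exact absurd (hab ▸ hb.1) h4
        · exact absurd (hab ▸ ha.1) h4
        · exact hab
      · exact (Finset.sort_nodup _ _).filter _
  simp only [adjacentSubword, readingWord, List.filter_map]
  change List.map f (List.filter P _) = List.map f (List.filter P _)
  rw [← key, List.map_map]
  exact List.map_congr_left fun x _ => (hfg x).symm

theorem adjacentSubword_eq_of_eqvGen {w : Equiv.Perm ℕ+} {D D' : RCGraph w}
    (h : Relation.EqvGen SimpleLadderMove D D') (k : ℕ+) :
    adjacentSubword k (readingWord D.1) = adjacentSubword k (readingWord D'.1) := by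
  induction h with
  | rel _ _ h => exact IsLadderMove.adjacentSubword_eq h k
  | refl _ => rfl
  | symm _ _ _ ih => exact ih.symm
  | trans _ _ _ _ _ ih ih' => exact ih.trans ih'

/-! ### The pattern `1432` -/

theorem containsPattern_perm1432_iff {w : Equiv.Perm ℕ+} :
    ContainsPattern perm1432 w ↔ ∃ a b c d : ℕ+, a < b ∧ b < c ∧ c < d ∧
      w a < w d ∧ w d < w c ∧ w c < w b := by
  constructor
  · rintro ⟨a, ha, h⟩
    refine ⟨a 0, a 1, a 2, a 3, ha (by decide), ha (by decide), ha (by decide), ?_, ?_, ?_⟩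
    · exact (h 0 3 (by decide)).mpr (by decide)
    · refine lt_of_le_of_ne (not_lt.mp fun hh => ?_) fun hh => ?_
      · exact absurd ((h 2 3 (by decide)).mp hh) (by decide)
      · exact (ha (show (2 : Fin 4) < 3 by decide)).ne (w.injective hh).symm
    · refine lt_of_le_of_ne (not_lt.mp fun hh => ?_) fun hh => ?_
      · exact absurd ((h 1 2 (by decide)).mp hh) (by decide)
      · exact (ha (show (1 : Fin 4) < 2 by decide)).ne (w.injective hh).symm
  · rintro ⟨a, b, c, d, hab, hbc, hcd, h1, h2, h3⟩
    refine ⟨![a, b, c, d], ?_, ?_⟩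
    · rw [Fin.strictMono_iff_lt_succ]
      intro i
      fin_cases i
      exacts [hab, hbc, hcd]
    · have key : ∀ x y : ℕ+, ∀ i j : Fin 4, w x < w y → perm1432 i < perm1432 j →
          (w x < w y ↔ perm1432 i < perm1432 j) := fun _ _ _ _ h h' => iff_of_true h h'
      have key' : ∀ x y : ℕ+, ∀ i j : Fin 4, w y < w x → ¬ perm1432 i < perm1432 j →
          (w x < w y ↔ perm1432 i < perm1432 j) := fun _ _ _ _ h h' =>
        iff_of_false (lt_asymm h) h'
      intro i j hij
      fin_cases i <;> fin_cases j <;> first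
        | exact absurd hij (by decide)
        | exact key _ _ _ _ (h1.trans (h2.trans h3)) (by decide)
        | exact key _ _ _ _ (h1.trans h2) (by decide)
        | exact key _ _ _ _ h1 (by decide)
        | exact key' _ _ _ _ h3 (by decide)
        | exact key' _ _ _ _ (h2.trans h3) (by decide)
        | exact key' _ _ _ _ h2 (by decide)

/-! ### Permutations fixing all large numbers -/

/-- `w` fixes every number larger than `n`. -/
def FixesAbove (n : ℕ) (w : Equiv.Perm ℕ+) : Prop :=
  ∀ x : ℕ+, n < (x : ℕ) → w x = x

theorem exists_fixesAbove {w : Equiv.Perm ℕ+} (hw : {i : ℕ+ | w i ≠ i}.Finite) :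
    ∃ n, FixesAbove n w := by
  obtain ⟨m, hm⟩ := hw.bddAbove
  refine ⟨m, fun x hx => ?_⟩
  by_contra h
  exact absurd (hm h) (not_le.mpr hx)

theorem FixesAbove.eq_one {w : Equiv.Perm ℕ+} (h : FixesAbove 0 w) : w = 1 :=
  Equiv.ext fun x => h x x.pos

/-- Inverted values `q` and `q + 1` are both at most `n`, so the swap stays inside the range. -/
theorem FixesAbove.simpleTransposition_mul {n : ℕ} {w : Equiv.Perm ℕ+} (h : FixesAbove n w)
    {q : ℕ+} (hq : w⁻¹ (q + 1) < w⁻¹ q) : FixesAbove n (simpleTransposition q * w) := by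
  intro x hx
  rw [Equiv.Perm.mul_apply, h x hx]
  apply simpleTransposition_of_ne
  · rintro rfl
    have h' : n < ((x + 1 : ℕ+) : ℕ) := by pnat_to_nat; lia
    rw [perm_inv_eq_of_apply_eq (h x hx), perm_inv_eq_of_apply_eq (h _ h')] at hq
    exact lt_asymm hq (PNat.lt_add_right x 1)
  · rintro rfl
    rw [perm_inv_eq_of_apply_eq (h _ hx)] at hq
    have h1 : n < ((w⁻¹ q : ℕ+) : ℕ) := lt_trans hx hq
    have h2 := h _ h1
    rw [perm_apply_inv] at h2
    rw [← h2] at hq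
    exact lt_asymm hq (PNat.lt_add_right q 1)

theorem FixesAbove.of_rowCycle_mul_shiftPerm {n : ℕ} {p : ℕ+} {v : Equiv.Perm ℕ+}
    (h : FixesAbove (n + 1) (rowCycle p * shiftPerm v)) : FixesAbove n v := by
  have h1 : (rowCycle p * shiftPerm v) 1 = p := by
    rw [Equiv.Perm.mul_apply, shiftPerm_apply_one, rowCycle_apply_one]
  have hp : (p : ℕ) ≤ n + 1 := by
    by_contra! hlt
    have h2 := (rowCycle p * shiftPerm v).injective ((h p hlt).trans h1.symm)
    rw [h2] at hlt
    have : ((1 : ℕ+) : ℕ) = 1 := rfl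
    omega
  intro x hx
  have h3 : n + 1 < ((x + 1 : ℕ+) : ℕ) := by pnat_to_nat; lia
  have h4 := h _ h3
  rw [Equiv.Perm.mul_apply, shiftPerm_apply_add_one, rowCycle_apply_add_one] at h4
  generalize v x = z at *
  split_ifs at h4 <;> pnat_to_nat <;> lia

theorem eq_shiftPerm_of_lt {p : ℕ+} {v : Equiv.Perm ℕ+} {n : ℕ+}
    (h : p < (rowCycle p * shiftPerm v) (n + 1)) :
    (rowCycle p * shiftPerm v) (n + 1) = v n + 1 := by
  rw [Equiv.Perm.mul_apply, shiftPerm_apply_add_one, rowCycle_apply_add_one] at h ⊢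
  split_ifs at h ⊢ with h'
  · exact absurd h (lt_asymm h')
  · rfl

theorem rowCycle_mul_shiftPerm_lt_iff {p : ℕ+} {v : Equiv.Perm ℕ+} {m n : ℕ+} :
    (rowCycle p * shiftPerm v) (m + 1) < (rowCycle p * shiftPerm v) (n + 1) ↔ v m < v n := by
  rw [Equiv.Perm.mul_apply, Equiv.Perm.mul_apply, shiftPerm_apply_add_one, shiftPerm_apply_add_one,
    rowCycle_add_one_lt_iff]

/-! ### The bottom RC-graph -/

theorem exists_adjacentSubword_rowWord_Iio {q p : ℕ+} (h : q + 1 < p) :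
    ∃ l, adjacentSubword q (rowWord (Finset.Iio p)) = (q + 1) :: l := by
  have h1 : Finset.Iio p = Finset.Ioo (q + 1) p ∪ Finset.Iio (q + 1 + 1) := by
    ext x
    simp only [Finset.mem_Iio, Finset.mem_union, Finset.mem_Ioo]
    pnat_to_nat; lia
  have h2 : adjacentSubword q (rowWord (Finset.Ioo (q + 1) p)) = [] := by
    rw [adjacentSubword, List.filter_eq_nil_iff]
    intro x hx
    have := (Finset.mem_Ioo.mp (mem_rowWord.mp hx)).1
    simp only [decide_eq_true_eq]
    pnat_to_nat; lia
  refine ⟨adjacentSubword q (rowWord (Finset.Iio (q + 1))), ?_⟩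
  rw [h1, rowWord_union, adjacentSubword_append, h2, rowWord_Iio_add_one]
  · simp [adjacentSubword]
  · intro a ha b hb
    rw [Finset.mem_Ioo] at ha
    rw [Finset.mem_Iio] at hb
    pnat_to_nat; lia

/-- If the values `q` and `q + 1` are inverted and a larger value precedes both, then some RC-graph
has the letter `q + 1` before the first letter `q`. -/
theorem exists_bottom (n : ℕ) : ∀ w : Equiv.Perm ℕ+, FixesAbove n w →
    ∃ D, IsReducedWord w (readingWord D) ∧ ∀ q b c d : ℕ+, b < c → c < d →
      w d = q → w c = q + 1 → q + 1 < w b →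
      ∃ l, adjacentSubword q (readingWord D) = (q + 1) :: l := by
  induction n with
  | zero =>
    intro w hw
    rw [hw.eq_one]
    refine ⟨∅, ?_, ?_⟩
    · rw [readingWord_empty, isReducedWord_iff]
      exact ⟨rfl, trivial⟩
    · rintro q b c d hbc - - hc hb
      rw [Equiv.Perm.one_apply] at hc hb
      rw [← hc] at hb
      exact absurd hb (lt_asymm hbc)
  | succ n ih =>
    intro w hw
    obtain ⟨v, hv⟩ := exists_eq_rowCycle_mul_shiftPerm w
    obtain ⟨D, hD, hD'⟩ := ih v (FixesAbove.of_rowCycle_mul_shiftPerm (hv ▸ hw))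
    refine ⟨addRow (Finset.Iio (w 1)) D, ?_, ?_⟩
    · have := isReducedWord_addRow_Iio hD (w 1)
      rwa [← hv] at this
    · intro q b c d hbc hcd hd hc hb
      rw [readingWord_addRow, adjacentSubword_append]
      generalize hp : w 1 = p at hv ⊢
      obtain ⟨c, rfl⟩ := (pnat_eq_one_or_eq_add_one c).resolve_left
        (by rintro rfl; exact not_lt_of_ge one_le hbc)
      obtain ⟨d, rfl⟩ := (pnat_eq_one_or_eq_add_one d).resolve_left
        (by rintro rfl; exact not_lt_of_ge one_le hcd)
      have hne : ∀ x : ℕ+, w (x + 1) ≠ p := fun x hx =>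
        pnat_add_one_ne_one x (w.injective (hx.trans hp.symm))
      have h1 := hne c
      have h2 := hne d
      rw [hc] at h1
      rw [hd] at h2
      -- Positions `c` and `d` are not 1, so `p = w 1` is neither `q` nor `q + 1`. If `p` is larger,
      -- the first row already reads `q + 1` before `q`. If it is smaller, the first row has neither
      -- letter, `b` is not 1 either, and the three positions survive in `v`.
      have h3 : q + 1 < p ∨ p < q := by
        rcases lt_or_gt_of_ne h1 with h1 | h1
        · exact Or.inl h1
        · exact Or.inr (lt_of_le_of_ne (PNat.lt_add_one_iff.mp h1) h2.symm)
      rcases h3 with h3 | h3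
      · obtain ⟨l, hl⟩ := exists_adjacentSubword_rowWord_Iio h3
        exact ⟨_, by rw [hl, List.cons_append]⟩
      · obtain ⟨b, rfl⟩ := (pnat_eq_one_or_eq_add_one b).resolve_left
          (by rintro rfl; rw [hp] at hb; pnat_to_nat; lia)
        obtain ⟨q, rfl⟩ := (pnat_eq_one_or_eq_add_one q).resolve_left
          (by rintro rfl; exact not_lt_of_ge one_le h3)
        have key : ∀ x, p < w (x + 1) → w (x + 1) = v x + 1 := by
          intro x hx
          rw [hv] at hx ⊢
          exact eq_shiftPerm_of_lt hx
        rw [key b (by pnat_to_nat; lia)] at hb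
        rw [key c (by rw [hc]; pnat_to_nat; lia)] at hc
        rw [key d (by rw [hd]; pnat_to_nat; lia)] at hd
        obtain ⟨l, hl⟩ := hD' q b c d (lt_of_add_lt_add_right hbc) (lt_of_add_lt_add_right hcd)
          (add_right_cancel hd) (add_right_cancel hc) (lt_of_add_lt_add_right hb)
        refine ⟨l.map (· + 1), ?_⟩
        rw [adjacentSubword_map_add_one, hl, adjacentSubword_eq_nil, List.nil_append,
          List.map_cons]
        intro x hx
        exact (Finset.mem_Iio.mp (mem_rowWord.mp hx)).trans h3

/-! ### Permutations containing `1432` -/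

/-- Some two RC-graphs of `w` have different orders of adjacent letters. -/
def HasDistinctAdjacentSubwords (w : Equiv.Perm ℕ+) : Prop :=
  ∃ D D' : Finset (ℕ+ × ℕ+), IsReducedWord w (readingWord D) ∧ IsReducedWord w (readingWord D') ∧
    ∃ k, adjacentSubword k (readingWord D) ≠ adjacentSubword k (readingWord D')

theorem adjacentSubword_addRow_ne {U : Finset ℕ+} {D D' : Finset (ℕ+ × ℕ+)} {k : ℕ+}
    (h : adjacentSubword k (readingWord D) ≠ adjacentSubword k (readingWord D')) :
    adjacentSubword (k + 1) (readingWord (addRow U D)) ≠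
      adjacentSubword (k + 1) (readingWord (addRow U D')) := by
  intro h'
  rw [readingWord_addRow, readingWord_addRow, adjacentSubword_append, adjacentSubword_append,
    adjacentSubword_map_add_one, adjacentSubword_map_add_one] at h'
  exact h (List.map_injective_iff.mpr (add_left_injective 1) (List.append_cancel_left h'))

theorem HasDistinctAdjacentSubwords.rowCycle_mul {v : Equiv.Perm ℕ+}
    (h : HasDistinctAdjacentSubwords v) (p : ℕ+) :
    HasDistinctAdjacentSubwords (rowCycle p * shiftPerm v) := by
  obtain ⟨D, D', h1, h2, k, hk⟩ := h
  exact ⟨_, _, isReducedWord_addRow_Iio h1 p, isReducedWord_addRow_Iio h2 p, k + 1,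
    adjacentSubword_addRow_ne hk⟩

theorem rowWord_insert_max {k : ℕ+} {U : Finset ℕ+} (h : ∀ x ∈ U, x < k) :
    rowWord (insert k U) = k :: rowWord U := by
  rw [Finset.insert_eq, rowWord_union (by simpa using h), rowWord_singleton]
  rfl

/-- Since `p ≤ q`, the extra crossing contributes the first letter of the word, and the descent at
`q` makes that letter create an inversion over `s_q w`. -/
theorem isReducedWord_addRow_insert {w v : Equiv.Perm ℕ+} {p q : ℕ+}
    (hv : simpleTransposition q * w = rowCycle p * shiftPerm v) (hpq : p ≤ q)
    (hq : w⁻¹ (q + 1) < w⁻¹ q) {D : Finset (ℕ+ × ℕ+)} (hD : IsReducedWord v (readingWord D)) :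
    IsReducedWord w (readingWord (addRow (insert q (Finset.Iio p)) D)) := by
  have h1 := isReducedWord_addRow_Iio hD p
  rw [isReducedWord_iff] at h1 ⊢
  rw [readingWord_addRow, rowWord_insert_max fun x hx => (Finset.mem_Iio.mp hx).trans_le hpq,
    List.cons_append, ← readingWord_addRow, wordProd_cons, h1.1, ← hv,
    simpleTransposition_mul_cancel]
  refine ⟨rfl, h1.2, ?_⟩
  rw [h1.1, ← hv]
  exact simpleTransposition_mul_descent hq

theorem exists_pattern_of_one_lt {p : ℕ+} {v : Equiv.Perm ℕ+} {a b c d : ℕ+} (ha : 1 < a)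
    (hab : a < b) (hbc : b < c) (hcd : c < d)
    (h1 : (rowCycle p * shiftPerm v) a < (rowCycle p * shiftPerm v) d)
    (h2 : (rowCycle p * shiftPerm v) d < (rowCycle p * shiftPerm v) c)
    (h3 : (rowCycle p * shiftPerm v) c < (rowCycle p * shiftPerm v) b) :
    ContainsPattern perm1432 v := by
  have key : ∀ x : ℕ+, 1 < x → ∃ n, x = n + 1 := fun x hx =>
    (pnat_eq_one_or_eq_add_one x).resolve_left hx.ne'
  obtain ⟨d, rfl⟩ := key d (((ha.trans hab).trans hbc).trans hcd)
  obtain ⟨c, rfl⟩ := key c ((ha.trans hab).trans hbc)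
  obtain ⟨b, rfl⟩ := key b (ha.trans hab)
  obtain ⟨a, rfl⟩ := key a ha
  rw [rowCycle_mul_shiftPerm_lt_iff] at h1 h2 h3
  exact containsPattern_perm1432_iff.mpr ⟨a, b, c, d, lt_of_add_lt_add_right hab,
    lt_of_add_lt_add_right hbc, lt_of_add_lt_add_right hcd, h1, h2, h3⟩

theorem simpleTransposition_mul_apply_of_ne {w : Equiv.Perm ℕ+} {q x : ℕ+} (h : w x ≠ q)
    (h' : w x ≠ q + 1) : (simpleTransposition q * w) x = w x :=
  simpleTransposition_of_ne h h'

theorem hasDistinctAdjacentSubwords_of_one {n : ℕ}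
    (ih : ∀ v, FixesAbove n v → ContainsPattern perm1432 v → HasDistinctAdjacentSubwords v)
    {w : Equiv.Perm ℕ+} (hw : FixesAbove (n + 1) w) (m : ℕ) :
    ∀ b c d : ℕ+, 1 < b → b < c → c < d → w 1 < w d → w d < w c → w c < w b →
      (w c : ℕ) ≤ w d + m → HasDistinctAdjacentSubwords w := by
  induction m with
  | zero =>
    intro b c d _ _ _ _ h _ h'
    exact absurd h (not_lt.mpr h')
  | succ m ihm =>
    intro b c d hb hbc hcd h1 h2 h3 hm
    generalize hq : w d = q at h1 h2 hm
    -- The position `x` of the value `q + 1` decides the case: if it differs from `c` and lies right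
    -- of `b`, it can replace `c` or `d` and shrink the gap `w c - w d`.
    obtain ⟨x, hx⟩ := w.surjective (q + 1)
    have hxd : x ≠ d := by
      rintro rfl
      exact (PNat.lt_add_right q 1).ne (hq.symm.trans hx)
    have hqb : q + 1 < w b := by pnat_to_nat; lia
    have hx1 : x ≠ 1 := by
      rintro rfl
      rw [hx] at h1
      exact lt_asymm h1 (PNat.lt_add_right q 1)
    have hxb : x ≠ b := by
      rintro rfl
      exact hqb.ne' hx
    rcases lt_or_gt_of_ne hxd with hlt | hgt
    · have hdes : w⁻¹ (q + 1) < w⁻¹ q := by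
        rwa [perm_inv_eq_of_apply_eq hx, perm_inv_eq_of_apply_eq hq]
      obtain ⟨v, hv⟩ := exists_eq_rowCycle_mul_shiftPerm (simpleTransposition q * w)
      have hfix := hw.simpleTransposition_mul hdes
      have hy1 : (simpleTransposition q * w) 1 = w 1 :=
        simpleTransposition_mul_apply_of_ne h1.ne (h1.trans (PNat.lt_add_right q 1)).ne
      rw [hy1] at hv
      have hvfix : FixesAbove n v := FixesAbove.of_rowCycle_mul_shiftPerm (hv ▸ hfix)
      by_cases hxc : x = c
      · obtain ⟨D, hD, hD'⟩ := exists_bottom (n + 1) w hw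
        obtain ⟨l, hl⟩ := hD' q b c d hbc hcd hq (hxc ▸ hx) hqb
        -- Any RC-graph of `v` would do here; only its existence matters, as the letter `q` is
        -- supplied by the first row.
        obtain ⟨E, hE, -⟩ := exists_bottom n v hvfix
        refine ⟨_, _, hD, isReducedWord_addRow_insert hv h1.le hdes hE, q, ?_⟩
        rw [hl, readingWord_addRow,
          rowWord_insert_max fun x hx => (Finset.mem_Iio.mp hx).trans h1]
        simp only [adjacentSubword, List.cons_append, List.filter_cons, true_or, decide_true,
          if_true]
        intro h
        exact (PNat.lt_add_right q 1).ne' (List.cons.inj h).1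
      · have hqc : q + 1 < w c := by
          refine lt_of_le_of_ne (PNat.add_one_le_iff.mpr h2) fun h => hxc ?_
          exact w.injective (hx.trans h)
        by_cases hbx : b < x
        · rcases lt_or_gt_of_ne hxc with hxc | hxc
          · refine ihm b x d hb hbx hlt ?_ ?_ ?_ ?_
            · rwa [hq]
            · rw [hq, hx]; exact PNat.lt_add_right q 1
            · rwa [hx]
            · rw [hx, hq]; pnat_to_nat; lia
          · refine ihm b c x hb hbc hxc ?_ ?_ h3 ?_
            · rw [hx]; exact h1.trans (PNat.lt_add_right q 1)
            · rwa [hx]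
            · rw [hx]; pnat_to_nat; lia
        · have hxb' : x < b := lt_of_le_of_ne (not_lt.mp hbx) hxb
          -- After swapping `q` and `q + 1`, the positions `x < b < c < d` form a `1432` in `s_q w`
          -- with `q` at `x` and `q + 1` at `d`. It avoids position 1, so it passes to `v`.
          have hpat : ContainsPattern perm1432 v := by
            have ex : (simpleTransposition q * w) x = q := by
              rw [Equiv.Perm.mul_apply, hx, simpleTransposition_succ]
            have ed : (simpleTransposition q * w) d = q + 1 := by
              rw [Equiv.Perm.mul_apply, hq, simpleTransposition_self]
            have ec : (simpleTransposition q * w) c = w c :=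
              simpleTransposition_mul_apply_of_ne h2.ne' hqc.ne'
            have eb : (simpleTransposition q * w) b = w b :=
              simpleTransposition_mul_apply_of_ne (h2.trans h3).ne' hqb.ne'
            rw [hv] at ex ed ec eb
            refine exists_pattern_of_one_lt (p := w 1) (lt_of_le_of_ne one_le hx1.symm) hxb' hbc hcd ?_ ?_ ?_
            · rw [ex, ed]; exact PNat.lt_add_right q 1
            · rwa [ed, ec]
            · rwa [ec, eb]
          obtain ⟨D, D', hD, hD', k, hk⟩ := ih v hvfix hpat
          exact ⟨_, _, isReducedWord_addRow_insert hv h1.le hdes hD,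
            isReducedWord_addRow_insert hv h1.le hdes hD', k + 1, adjacentSubword_addRow_ne hk⟩
    · have hqc : q + 1 < w c := by
        refine lt_of_le_of_ne (PNat.add_one_le_iff.mpr h2) fun h => ?_
        rw [← w.injective (hx.trans h)] at hcd
        exact lt_asymm hcd hgt
      refine ihm b c x hb hbc (hcd.trans hgt) ?_ ?_ h3 ?_
      · rw [hx]; exact h1.trans (PNat.lt_add_right q 1)
      · rwa [hx]
      · rw [hx]; pnat_to_nat; lia

theorem hasDistinctAdjacentSubwords (n : ℕ) : ∀ w, FixesAbove n w →
    ContainsPattern perm1432 w → HasDistinctAdjacentSubwords w := by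
  induction n with
  | zero =>
    intro w hw h
    obtain ⟨a, b, c, d, hab, hbc, hcd, h1, h2, h3⟩ := containsPattern_perm1432_iff.mp h
    rw [hw.eq_one] at h2
    exact absurd h2 (lt_asymm hcd)
  | succ n ih =>
    intro w hw h
    obtain ⟨a, b, c, d, hab, hbc, hcd, h1, h2, h3⟩ := containsPattern_perm1432_iff.mp h
    rcases eq_or_lt_of_le (one_le : 1 ≤ a) with rfl | ha
    -- `w c` is a crude bound for the gap `w c - w d`.
    · exact hasDistinctAdjacentSubwords_of_one ih hw (w c) b c d hab hbc hcd h1 h2 h3 (by omega)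
    · obtain ⟨v, hv⟩ := exists_eq_rowCycle_mul_shiftPerm w
      rw [hv]
      rw [hv] at hw h1 h2 h3
      exact (ih v hw.of_rowCycle_mul_shiftPerm
        (exists_pattern_of_one_lt ha hab hbc hcd h1 h2 h3)).rowCycle_mul _

/-! ### RC-graphs linked by simple ladder moves -/

/-- `D` and `D'` are RC-graphs of `w` connected by simple ladder moves. -/
def Linked (w : Equiv.Perm ℕ+) (D D' : Finset (ℕ+ × ℕ+)) : Prop :=
  ∃ (h : IsReducedWord w (readingWord D)) (h' : IsReducedWord w (readingWord D')),
    Relation.EqvGen SimpleLadderMove (⟨D, h⟩ : RCGraph w) ⟨D', h'⟩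

theorem Linked.refl {w : Equiv.Perm ℕ+} {D : Finset (ℕ+ × ℕ+)}
    (h : IsReducedWord w (readingWord D)) : Linked w D D :=
  ⟨h, h, .refl _⟩

theorem Linked.symm {w : Equiv.Perm ℕ+} {D D' : Finset (ℕ+ × ℕ+)} (h : Linked w D D') :
    Linked w D' D := by
  obtain ⟨h1, h2, h⟩ := h
  exact ⟨h2, h1, h.symm⟩

theorem Linked.trans {w : Equiv.Perm ℕ+} {D D' D'' : Finset (ℕ+ × ℕ+)} (h : Linked w D D')
    (h' : Linked w D' D'') : Linked w D D'' := by
  obtain ⟨h1, h2, h⟩ := h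
  obtain ⟨h3, h4, h'⟩ := h'
  exact ⟨h1, h4, h.trans _ _ _ h'⟩

theorem IsLadderMove.addRow {D D' : Finset (ℕ+ × ℕ+)} (h : IsLadderMove 0 D D')
    (U : Finset ℕ+) : IsLadderMove 0 (addRow U D) (addRow U D') := by
  obtain ⟨i, j, r, hi, h1, h2, h3, h4, -, rfl⟩ := h
  refine ⟨i + 1, j, r + 1, ?_, ?_, ?_, ?_, ?_, ?_, ?_⟩
  · pnat_to_nat; lia
  · rwa [add_one_mem_addRow]
  · rwa [add_one_mem_addRow]
  · rwa [add_one_mem_addRow]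
  · rwa [add_one_mem_addRow]
  · intro i' h5 h6
    pnat_to_nat; lia
  · refine (addRow_ext ?_ ?_).symm
    · intro m
      simp [one_mem_addRow, (pnat_add_one_ne_one _).symm]
    · intro m m'
      simp [add_one_mem_addRow]

theorem IsReducedWord.of_addRow {w : Equiv.Perm ℕ+} {U : Finset ℕ+} {D : Finset (ℕ+ × ℕ+)}
    (h : IsReducedWord w (readingWord (addRow U D))) :
    IsReducedWord (wordProd (readingWord D)) (readingWord D) := by
  rw [readingWord_addRow] at h
  refine ⟨rfl, fun l hl => ?_⟩
  have := h.of_append.2 (l.map (· + 1)) (by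
    rw [wordProd_map_add_one, wordProd_map_add_one, hl])
  simpa using this

theorem IsReducedWord.addRow_congr {w v : Equiv.Perm ℕ+} {U : Finset ℕ+}
    {D D' : Finset (ℕ+ × ℕ+)} (h : IsReducedWord w (readingWord (addRow U D)))
    (hD : IsReducedWord v (readingWord D)) (hD' : IsReducedWord v (readingWord D')) :
    IsReducedWord w (readingWord (addRow U D')) := by
  apply h.of_length_eq
  · rw [← h.1, readingWord_addRow, readingWord_addRow, wordProd_append, wordProd_append,
      wordProd_map_add_one, wordProd_map_add_one, hD.1, hD'.1]
  · rw [readingWord_addRow, readingWord_addRow, List.length_append, List.length_append,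
      List.length_map, List.length_map,
      le_antisymm (hD.2 _ hD'.1) (hD'.2 _ hD.1)]

theorem Linked.addRow {w v : Equiv.Perm ℕ+} {U : Finset ℕ+} {D D' : Finset (ℕ+ × ℕ+)}
    (h : IsReducedWord w (readingWord (addRow U D))) (hv : Linked v D D') :
    Linked w (addRow U D) (addRow U D') := by
  obtain ⟨h1, h2, h3⟩ := hv
  have hred : ∀ F : RCGraph v, IsReducedWord w (readingWord (_root_.addRow U F.1)) := fun F =>
    h.addRow_congr h1 F.2
  have key : ∀ F F' : RCGraph v, Relation.EqvGen SimpleLadderMove F F' →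
      Linked w (_root_.addRow U F.1) (_root_.addRow U F'.1) := by
    intro F F' hF
    induction hF with
    | rel F F' hF => exact ⟨hred F, hred F', .rel _ _ (IsLadderMove.addRow hF U)⟩
    | refl F => exact .refl (hred F)
    | symm _ _ _ ih => exact ih.symm
    | trans _ _ _ _ _ ih ih' => exact ih.trans ih'
  exact key _ _ h3

/-! ### Permutations avoiding `1432` -/

/-- The split is at the first empty column `p`. For an RC-graph of `w` this column is `w 1`, because
the letters beyond `p` do not move the value `p`. -/
theorem exists_eq_union_Iio (U : Finset ℕ+) :
    ∃ (p : ℕ+) (V : Finset ℕ+), U = V ∪ Finset.Iio p ∧ ∀ x ∈ V, p < x := by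
  obtain ⟨p, hp, hmin⟩ := WellFounded.has_min (wellFounded_lt (α := ℕ+)) {x | x ∉ U}
    (Infinite.exists_notMem_finset U)
  refine ⟨p, U.filter (p < ·), ?_, by simp⟩
  ext x
  simp only [Finset.mem_union, Finset.mem_filter, Finset.mem_Iio]
  constructor
  · intro hx
    rcases lt_trichotomy x p with h | rfl | h
    · exact Or.inr h
    · exact absurd hx hp
    · exact Or.inl ⟨hx, h⟩
  · rintro (⟨hx, -⟩ | hx)
    · exact hx
    · by_contra hc
      exact hmin x hc hx

theorem wordProd_apply_of_le {p : ℕ+} {l : List ℕ+} (h : ∀ k ∈ l, p < k) {x : ℕ+} (hx : x ≤ p) :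
    wordProd l x = x := by
  induction l with
  | nil => rfl
  | cons k l ih =>
    rw [wordProd_cons, Equiv.Perm.mul_apply, ih fun m hm => h m (List.mem_cons_of_mem _ hm)]
    have hk := hx.trans_lt (h k List.mem_cons_self)
    exact simpleTransposition_of_ne hk.ne (hk.trans (PNat.lt_add_right k 1)).ne

theorem lt_wordProd_apply {p : ℕ+} {l : List ℕ+} (h : ∀ k ∈ l, p < k) {x : ℕ+} (hx : p < x) :
    p < wordProd l x := by
  by_contra! hc
  have := (wordProd l).injective (wordProd_apply_of_le h hc)
  exact absurd hx (not_lt.mpr (this ▸ hc))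

/-- The descents of the pattern survive because inversions do; only the smallest entry needs care. A
value at most `p` is untouched by `l` and stays smallest. Otherwise position 1, whose value is `p`,
takes its place. -/
theorem containsPattern_of_shiftPerm {p : ℕ+} {l : List ℕ+} (hl : ∀ k ∈ l, p < k)
    {w v : Equiv.Perm ℕ+} (hw : w = wordProd l * (rowCycle p * shiftPerm v))
    (hinv : inversions (rowCycle p * shiftPerm v) ⊆ inversions w)
    (h : ContainsPattern perm1432 v) : ContainsPattern perm1432 w := by
  obtain ⟨a, b, c, d, hab, hbc, hcd, h1, h2, h3⟩ := containsPattern_perm1432_iff.mp h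
  have hinv' : ∀ m n : ℕ+, m < n → v n < v m → w (n + 1) < w (m + 1) := fun m n hmn hv =>
    (hinv (mem_inversions.mpr ⟨add_lt_add_left hmn 1,
      rowCycle_mul_shiftPerm_lt_iff.mpr hv⟩)).2
  have hb := hinv' b c hbc h3
  have hc := hinv' c d hcd h2
  rw [containsPattern_perm1432_iff]
  have had := (rowCycle_mul_shiftPerm_lt_iff (p := p)).mpr h1
  have hwa : ∀ x, w x = wordProd l ((rowCycle p * shiftPerm v) x) := fun x => by
    rw [hw, Equiv.Perm.mul_apply]
  rcases le_or_gt ((rowCycle p * shiftPerm v) (a + 1)) p with ha | ha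
  · refine ⟨a + 1, b + 1, c + 1, d + 1, add_lt_add_left hab 1, add_lt_add_left hbc 1,
      add_lt_add_left hcd 1, ?_, hc, hb⟩
    rw [hwa, hwa (d + 1), wordProd_apply_of_le hl ha]
    rcases le_or_gt ((rowCycle p * shiftPerm v) (d + 1)) p with hd | hd
    · rwa [wordProd_apply_of_le hl hd]
    · exact ha.trans_lt (lt_wordProd_apply hl hd)
  · refine ⟨1, b + 1, c + 1, d + 1, PNat.lt_add_left 1 b, add_lt_add_left hbc 1,
      add_lt_add_left hcd 1, ?_, hc, hb⟩
    rw [hwa, hwa (d + 1), Equiv.Perm.mul_apply, shiftPerm_apply_one, rowCycle_apply_one,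
      wordProd_apply_of_le hl le_rfl]
    exact lt_wordProd_apply hl (ha.trans had)

theorem readingWord_addRow_union {p : ℕ+} {V : Finset ℕ+} (hV : ∀ x ∈ V, p < x)
    (D : Finset (ℕ+ × ℕ+)) : readingWord (addRow (V ∪ Finset.Iio p) D) =
      rowWord V ++ (rowWord (Finset.Iio p) ++ (readingWord D).map (· + 1)) := by
  rw [readingWord_addRow, rowWord_union, List.append_assoc]
  exact fun a ha b hb => (Finset.mem_Iio.mp hb).trans (hV a ha)

theorem wordProd_Iio_append (p : ℕ+) (l : List ℕ+) :
    wordProd (rowWord (Finset.Iio p) ++ l.map (· + 1)) = rowCycle p * shiftPerm (wordProd l) := by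
  rw [wordProd_append, wordProd_map_add_one, rowCycle]

theorem eq_wordProd_mul_of_addRow_union {w : Equiv.Perm ℕ+} {p : ℕ+} {V : Finset ℕ+}
    (hV : ∀ x ∈ V, p < x) {D : Finset (ℕ+ × ℕ+)}
    (h : IsReducedWord w (readingWord (addRow (V ∪ Finset.Iio p) D))) :
    w = wordProd (rowWord V) * (rowCycle p * shiftPerm (wordProd (readingWord D))) ∧
      inversions (rowCycle p * shiftPerm (wordProd (readingWord D))) ⊆ inversions w := by
  rw [readingWord_addRow_union hV] at h
  have h' := h.inversions_subset
  rw [wordProd_Iio_append] at h'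
  rw [← h.1, wordProd_append, wordProd_Iio_append] at h' ⊢
  exact ⟨rfl, h'⟩

theorem apply_one_of_addRow_union {w : Equiv.Perm ℕ+} {p : ℕ+} {V : Finset ℕ+}
    (hV : ∀ x ∈ V, p < x) {D : Finset (ℕ+ × ℕ+)}
    (h : IsReducedWord w (readingWord (addRow (V ∪ Finset.Iio p) D))) : w 1 = p := by
  rw [(eq_wordProd_mul_of_addRow_union hV h).1, Equiv.Perm.mul_apply, Equiv.Perm.mul_apply,
    shiftPerm_apply_one, rowCycle_apply_one]
  exact wordProd_apply_of_le (fun k hk => hV k (mem_rowWord.mp hk)) le_rfl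

theorem not_containsPattern_of_addRow {w : Equiv.Perm ℕ+} {U : Finset ℕ+}
    {D : Finset (ℕ+ × ℕ+)} (h : IsReducedWord w (readingWord (addRow U D)))
    (hw : ¬ ContainsPattern perm1432 w) :
    ¬ ContainsPattern perm1432 (wordProd (readingWord D)) := by
  obtain ⟨p, V, rfl, hV⟩ := exists_eq_union_Iio U
  obtain ⟨h1, h2⟩ := eq_wordProd_mul_of_addRow_union hV h
  exact fun h' => hw (containsPattern_of_shiftPerm (fun k hk => hV k (mem_rowWord.mp hk)) h1 h2 h')

/-! ### Moving a crossing from the first row to the second. -/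

theorem simpleTransposition_comm {p m : ℕ+} (h : p + 1 < m) :
    simpleTransposition m * simpleTransposition p =
      simpleTransposition p * simpleTransposition m := by
  refine Equiv.ext fun x => ?_
  simp only [Equiv.Perm.mul_apply, simpleTransposition_apply]
  split_ifs <;> pnat_to_nat <;> lia

theorem simpleTransposition_mul_rowCycle {p m : ℕ+} (h : p < m) :
    simpleTransposition m * rowCycle p = rowCycle p * simpleTransposition m := by
  induction p using PNat.recOn with
  | one => rw [rowCycle_one, mul_one, one_mul]
  | succ p ih =>
    rw [rowCycle_add_one, ← mul_assoc, simpleTransposition_comm h, mul_assoc,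
      ih ((PNat.lt_add_right p 1).trans h), mul_assoc]

/-- If the first row has a crossing in column `k` right of its left-justified part, and the first
gap of the second row is not left of column `k`, then `1432` occurs. -/
theorem le_of_not_containsPattern {w v : Equiv.Perm ℕ+} {p p' k : ℕ+} {l l' : List ℕ+}
    (hw : ¬ ContainsPattern perm1432 w) (hl : ∀ x ∈ l ++ [k], p < x)
    (h : IsReducedWord w (l ++ k :: l')) (hv : wordProd l' = rowCycle p * shiftPerm v)
    (hp' : v 1 = p') : p' < k := by
  have hpk : p < k := hl k (by simp)
  by_contra! hc
  have hdes : (wordProd l')⁻¹ k < (wordProd l')⁻¹ (k + 1) :=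
    ((isReducedWord_iff.mp h.of_append).2).2
  have hinv := h.inversions_subset
  have hinv' : inversions (wordProd l') ⊆ inversions w := by
    have : l ++ k :: l' = (l ++ [k]) ++ l' := by simp
    exact (this ▸ h).inversions_subset
  have hwx : ∀ x, w x = wordProd (l ++ [k]) (wordProd l' x) := by
    intro x
    rw [← Equiv.Perm.mul_apply, ← wordProd_append, ← h.1, List.append_assoc]
    rfl
  rw [wordProd_cons] at hinv
  generalize wordProd l' = x at *
  have hx1 : x 1 = p := by
    rw [hv, Equiv.Perm.mul_apply, shiftPerm_apply_one, rowCycle_apply_one]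
  have hx2 : x (1 + 1) = p' + 1 := by
    rw [hv, Equiv.Perm.mul_apply, shiftPerm_apply_add_one, hp', rowCycle_apply_add_one,
      if_neg (not_lt.mpr (hpk.le.trans hc))]
  -- If `p' ≥ k`, then `x` has values `p` and `p' + 1` at positions 1 and 2, and `k`, `k + 1` at
  -- positions `b < c`. The letter `k` inverts the last two, so `1, 2, b, c` become a `1432` in `w`;
  -- the equality `p' = k` would put `k + 1` at position 2 and leave no room for `b`.
  obtain ⟨b, hb⟩ := x.surjective k
  obtain ⟨c, hcc⟩ := x.surjective (k + 1)
  rw [perm_inv_eq_of_apply_eq hb, perm_inv_eq_of_apply_eq hcc] at hdes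
  have hb1 : b ≠ 1 := by
    rintro rfl
    exact hpk.ne (hx1.symm.trans hb)
  rcases eq_or_lt_of_le hc with rfl | hlt
  · rw [x.injective (hcc.trans hx2.symm)] at hdes
    exact hb1 (le_antisymm (PNat.lt_add_one_iff.mp hdes) one_le)
  · have hb2 : b ≠ 1 + 1 := by
      rintro rfl
      rw [hx2] at hb
      rw [← hb] at hlt
      exact lt_asymm hlt (PNat.lt_add_right p' 1)
    have h2b : 1 + 1 < b :=
      lt_of_le_of_ne (PNat.add_one_le_iff.mpr (lt_of_le_of_ne one_le hb1.symm)) hb2.symm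
    apply hw
    rw [containsPattern_perm1432_iff]
    refine ⟨1, 1 + 1, b, c, PNat.lt_add_right 1 1, h2b, hdes, ?_, ?_, ?_⟩
    · rw [hwx, hwx c, hx1, hcc, wordProd_apply_of_le hl le_rfl]
      exact lt_wordProd_apply hl (hpk.trans (PNat.lt_add_right k 1))
    · refine (hinv (mem_inversions.mpr ⟨hdes, ?_⟩)).2
      rw [Equiv.Perm.mul_apply, Equiv.Perm.mul_apply, hb, hcc, simpleTransposition_self,
        simpleTransposition_succ]
      exact PNat.lt_add_right k 1
    · refine (hinv' (mem_inversions.mpr ⟨h2b, ?_⟩)).2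
      rw [hx2, hb]
      exact hlt.trans (PNat.lt_add_right p' 1)

/-- All cells `(i, j)` of `D` satisfy `i + j ≤ N`. -/
def CellsBelow (N : ℕ) (D : Finset (ℕ+ × ℕ+)) : Prop :=
  ∀ i j : ℕ+, (i, j) ∈ D → (i : ℕ) + j ≤ N

theorem CellsBelow.eq_empty {D : Finset (ℕ+ × ℕ+)} (h : CellsBelow 0 D) : D = ∅ := by
  rw [Finset.eq_empty_iff_forall_notMem]
  rintro ⟨i, j⟩ hij
  have := h i j hij
  have := i.pos
  omega

theorem CellsBelow.of_addRow {N : ℕ} {U : Finset ℕ+} {D : Finset (ℕ+ × ℕ+)}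
    (h : CellsBelow (N + 1) (addRow U D)) : CellsBelow N D := by
  intro i j hij
  have := h (i + 1) j (add_one_mem_addRow.mpr hij)
  pnat_to_nat; lia

theorem CellsBelow.addRow_congr {N : ℕ} {U : Finset ℕ+} {D D' : Finset (ℕ+ × ℕ+)}
    (h : CellsBelow (N + 1) (addRow U D)) (h' : CellsBelow N D') :
    CellsBelow (N + 1) (addRow U D') := by
  intro i j hij
  rcases pnat_eq_one_or_eq_add_one i with rfl | ⟨i, rfl⟩
  · exact h 1 j (one_mem_addRow.mpr (one_mem_addRow.mp hij))
  · have := h' i j (add_one_mem_addRow.mp hij)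
    pnat_to_nat; lia

/-- The move takes `(2, k)` to `(1, k + 1)`; it is applied in reverse, to lower the leftmost extra
crossing of the first row. -/
theorem isLadderMove_addRow {V : Finset ℕ+} {p p' k : ℕ+} (hV : ∀ x ∈ V, k + 1 < x)
    (hp : p ≤ k) (hp' : p' ≤ k) (D : Finset (ℕ+ × ℕ+)) :
    IsLadderMove 0 (addRow (V ∪ Finset.Iio p) (addRow (insert k (Finset.Iio p')) D))
      (addRow ((V ∪ {k + 1}) ∪ Finset.Iio p) (addRow (Finset.Iio p') D)) := by
  have hk := PNat.lt_add_right k 1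
  have hkV : k ∉ V := fun h => lt_asymm (hV k h) hk
  have hkV' : k + 1 ∉ V := fun h => lt_irrefl _ (hV _ h)
  refine ⟨1 + 1, k, 1, rfl, ?_, ?_, ?_, ?_, ?_, ?_⟩
  · simp [add_one_mem_addRow, one_mem_addRow]
  · simp [add_one_mem_addRow, one_mem_addRow, hk.ne', hp'.trans hk.le]
  · simp [one_mem_addRow, hkV, hp]
  · simp [one_mem_addRow, hkV', hp.trans hk.le]
  · intro i h1 h2
    exact absurd (PNat.lt_add_one_iff.mp h2) (not_le.mpr h1)
  · refine (addRow_ext ?_ ?_).symm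
    · intro j
      simp only [Finset.mem_insert, Finset.mem_erase, one_mem_addRow, Prod.mk.injEq, true_and,
        Finset.mem_union, Finset.mem_singleton, ne_eq, (pnat_add_one_ne_one 1).symm, false_and,
        not_false_eq_true]
      tauto
    · intro i j
      rcases pnat_eq_one_or_eq_add_one i with rfl | ⟨i, rfl⟩
      · have : j < p' → j ≠ k := fun h h' => absurd (h' ▸ h) (not_lt.mpr hp')
        simp only [Finset.mem_insert, Finset.mem_erase, one_mem_addRow, add_one_mem_addRow,
          Prod.mk.injEq, true_and, ne_eq, pnat_add_one_ne_one, false_and, false_or,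
          Finset.mem_Iio]
        tauto
      · simp [add_one_mem_addRow, pnat_add_one_ne_one]

theorem exists_linked_card_lt {w : Equiv.Perm ℕ+} (hw : ¬ ContainsPattern perm1432 w) {N : ℕ}
    {U : Finset ℕ+} {p' : ℕ+} {D : Finset (ℕ+ × ℕ+)}
    (h : IsReducedWord w (readingWord (addRow U (addRow (Finset.Iio p') D))))
    (hN : CellsBelow N (addRow U (addRow (Finset.Iio p') D))) (hU : U ≠ Finset.Iio (w 1)) :
    ∃ U' D', U'.card < U.card ∧ CellsBelow N (addRow U' D') ∧
      Linked w (addRow U (addRow (Finset.Iio p') D)) (addRow U' D') := by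
  obtain ⟨p, V, rfl, hV⟩ := exists_eq_union_Iio U
  have hw1 := apply_one_of_addRow_union hV h
  have hne : V.Nonempty := by
    rw [Finset.nonempty_iff_ne_empty]
    rintro rfl
    exact hU (by rw [hw1, Finset.empty_union])
  -- The leftmost extra crossing is the one that moves: minimality keeps column `m - 1` of the first
  -- row empty, the case `m - 1 = p` included.
  obtain ⟨m, hm⟩ : ∃ m, m = V.min' hne := ⟨_, rfl⟩
  have hmV : m ∈ V := hm ▸ V.min'_mem hne
  have hpm : p < m := hV m hmV
  obtain ⟨k, rfl⟩ := (pnat_eq_one_or_eq_add_one m).resolve_left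
    (by rintro rfl; exact not_lt_of_ge one_le hpm)
  have hpk : p ≤ k := PNat.lt_add_one_iff.mp hpm
  set V' := V.erase (k + 1) with hV'def
  have hV' : ∀ x ∈ V', k + 1 < x := by
    intro x hx
    rw [hV'def, Finset.mem_erase] at hx
    exact lt_of_le_of_ne (hm ▸ V.min'_le x hx.2) hx.1.symm
  have hVV : V = V' ∪ {k + 1} := by
    ext x
    simp only [hV'def, Finset.mem_union, Finset.mem_erase, Finset.mem_singleton]
    by_cases hx : x = k + 1
    · simp [hx, hmV]
    · simp [hx]
  have hV'p : ∀ x ∈ V', p < x := fun x hx => hpm.trans (hV' x hx)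
  have hrV : rowWord V = rowWord V' ++ [k + 1] := by
    rw [hVV, rowWord_union (by simpa using hV'), rowWord_singleton]
  have hr := h
  rw [readingWord_addRow_union hV, hrV, List.append_assoc, List.singleton_append] at hr
  have hp'k : p' ≤ k := by
    refine PNat.lt_add_one_iff.mp (le_of_not_containsPattern hw (p := p)
      (v := wordProd (readingWord (addRow (Finset.Iio p') D))) ?_ hr (wordProd_Iio_append _ _) ?_)
    · rw [← hrV]
      exact fun x hx => hV x (mem_rowWord.mp hx)
    · rw [readingWord_addRow, wordProd_Iio_append, Equiv.Perm.mul_apply, shiftPerm_apply_one,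
        rowCycle_apply_one]
  have hE : readingWord (addRow (V' ∪ Finset.Iio p) (addRow (insert k (Finset.Iio p')) D)) =
      rowWord V' ++ (rowWord (Finset.Iio p) ++ ((k + 1) ::
        (readingWord (addRow (Finset.Iio p') D)).map (· + 1))) := by
    rw [readingWord_addRow_union hV'p, readingWord_addRow,
      rowWord_insert_max fun x hx => (Finset.mem_Iio.mp hx).trans_le hp'k, readingWord_addRow]
    simp
  have hred : IsReducedWord w (readingWord
      (addRow (V' ∪ Finset.Iio p) (addRow (insert k (Finset.Iio p')) D))) := by
    apply hr.of_length_eq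
    -- The letter `k + 1` slides past the letters `p - 1, …, 1`, with which it commutes since `p < k
    -- + 1`.
    · rw [hE, ← hr.1, wordProd_append, wordProd_append, wordProd_append, wordProd_cons,
        wordProd_cons, wordProd_append, ← rowCycle, ← mul_assoc (rowCycle p),
        ← simpleTransposition_mul_rowCycle hpm, mul_assoc]
    · rw [hE]
      simp only [List.length_append, List.length_cons, List.length_map]
      omega
  have hmove := isLadderMove_addRow hV' hpk hp'k D
  rw [← hVV] at hmove
  refine ⟨V' ∪ Finset.Iio p, addRow (insert k (Finset.Iio p')) D, ?_, ?_, h, hred, ?_⟩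
  · apply Finset.card_lt_card
    rw [Finset.ssubset_iff_of_subset
      (Finset.union_subset_union_left (Finset.erase_subset _ _))]
    refine ⟨k + 1, Finset.mem_union_left _ hmV, ?_⟩
    simp [hpm.le]
  · intro i j hij
    rcases pnat_eq_one_or_eq_add_one i with rfl | ⟨i, rfl⟩
    · apply hN
      rw [one_mem_addRow] at hij ⊢
      exact Finset.union_subset_union_left (Finset.erase_subset _ _) hij
    · rw [add_one_mem_addRow] at hij
      rcases pnat_eq_one_or_eq_add_one i with rfl | ⟨i, rfl⟩
      · rw [one_mem_addRow, Finset.mem_insert] at hij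
        rcases hij with rfl | hij
        · have := hN 1 (j + 1) (one_mem_addRow.mpr (Finset.mem_union_left _ hmV))
          pnat_to_nat; lia
        · exact hN _ _ (add_one_mem_addRow.mpr (one_mem_addRow.mpr hij))
      · exact hN _ _ (add_one_mem_addRow.mpr (add_one_mem_addRow.mpr (add_one_mem_addRow.mp hij)))
  · refine Relation.EqvGen.symm _ _ (Relation.EqvGen.rel _ _ ?_)
    exact hmove

/-! ### Left-justifying the first row, and the induction on rows. -/

theorem exists_linked_addRow_Iio_succ {N : ℕ}
    (ih : ∀ v : Equiv.Perm ℕ+, ¬ ContainsPattern perm1432 v → ∀ D,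
      IsReducedWord v (readingWord D) → CellsBelow N D →
      ∃ D', CellsBelow N (addRow (Finset.Iio (v 1)) D') ∧
        Linked v D (addRow (Finset.Iio (v 1)) D'))
    {w : Equiv.Perm ℕ+} (hw : ¬ ContainsPattern perm1432 w) (m : ℕ) :
    ∀ U D, U.card ≤ m → IsReducedWord w (readingWord (addRow U D)) →
      CellsBelow (N + 1) (addRow U D) →
      ∃ D', CellsBelow (N + 1) (addRow (Finset.Iio (w 1)) D') ∧
        Linked w (addRow U D) (addRow (Finset.Iio (w 1)) D') := by
  induction m with
  | zero =>
    intro U D hU h hN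
    obtain ⟨p, V, rfl, hV⟩ := exists_eq_union_Iio U
    have hw1 := apply_one_of_addRow_union hV h
    have hV0 : V = ∅ := by
      have := Finset.card_eq_zero.mp (Nat.le_zero.mp hU)
      exact (Finset.union_eq_empty.mp this).1
    rw [hV0, Finset.empty_union, ← hw1] at h hN ⊢
    exact ⟨D, hN, .refl h⟩
  | succ m ihm =>
    intro U D hU h hN
    by_cases hUp : U = Finset.Iio (w 1)
    · rw [hUp] at h hN ⊢
      exact ⟨D, hN, .refl h⟩
    -- Lowering a crossing can spoil the second row, so it is left-justified afresh on every pass;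
    -- termination comes from the size of the first row.
    · obtain ⟨D', hD', hlink⟩ := ih _ (not_containsPattern_of_addRow h hw) D h.of_addRow
        hN.of_addRow
      have hlink' := Linked.addRow h hlink
      obtain ⟨U', D'', hcard, hN', hlink''⟩ :=
        exists_linked_card_lt hw hlink'.2.1 (hN.addRow_congr hD') hUp
      obtain ⟨F, hF, hlinkF⟩ := ihm U' D'' (by omega) hlink''.2.1 hN'
      exact ⟨F, hF, (hlink'.trans hlink'').trans hlinkF⟩

theorem exists_linked_addRow_Iio (N : ℕ) : ∀ w : Equiv.Perm ℕ+, ¬ ContainsPattern perm1432 w →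
    ∀ D, IsReducedWord w (readingWord D) → CellsBelow N D →
      ∃ D', CellsBelow N (addRow (Finset.Iio (w 1)) D') ∧
        Linked w D (addRow (Finset.Iio (w 1)) D') := by
  induction N with
  | zero =>
    intro w _ D h hN
    have hD : D = ∅ := hN.eq_empty
    have hw1 : w 1 = 1 := by
      rw [← h.1, hD, readingWord_empty]
      rfl
    have hadd : addRow (Finset.Iio (w 1)) ∅ = D := by
      refine (addRow_ext ?_ ?_).symm
      · simp [hD, hw1]
      · simp [hD]
    exact ⟨∅, hadd ▸ hN, hadd.symm ▸ .refl h⟩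
  | succ N ih =>
    intro w hw D h hN
    obtain ⟨U, D', rfl⟩ := exists_eq_addRow D
    exact exists_linked_addRow_Iio_succ ih hw _ U D' le_rfl h hN

theorem linked_of_not_containsPattern (N : ℕ) : ∀ w : Equiv.Perm ℕ+,
    ¬ ContainsPattern perm1432 w → ∀ D D', IsReducedWord w (readingWord D) →
      IsReducedWord w (readingWord D') → CellsBelow N D → CellsBelow N D' → Linked w D D' := by
  induction N with
  | zero =>
    intro w _ D D' h _ hN hN'
    rw [hN'.eq_empty, ← hN.eq_empty]
    exact .refl h
  | succ N ih =>
    intro w hw D D' h h' hN hN'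
    obtain ⟨E, hE, hlink⟩ := exists_linked_addRow_Iio _ w hw D h hN
    obtain ⟨E', hE', hlink'⟩ := exists_linked_addRow_Iio _ w hw D' h' hN'
    have hred := hlink.2.1
    have hred' := hlink'.2.1
    -- The common first row cancels, so both lower parts are RC-graphs of one permutation.
    have hv : wordProd (readingWord E') = wordProd (readingWord E) := by
      have h1 := hred.1
      have h2 := hred'.1
      rw [readingWord_addRow, wordProd_Iio_append] at h1 h2
      exact shiftPerm_injective (mul_left_cancel (h2.trans h1.symm))
    have := ih _ (not_containsPattern_of_addRow hred hw) E E' hred.of_addRow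
      (hv ▸ hred'.of_addRow) hE.of_addRow hE'.of_addRow
    exact (hlink.trans (Linked.addRow hred this)).trans hlink'.symm

theorem exists_cellsBelow (D : Finset (ℕ+ × ℕ+)) : ∃ N, CellsBelow N D :=
  ⟨D.sup fun c => (c.1 : ℕ) + c.2, fun _ _ h =>
    Finset.le_sup (f := fun c : ℕ+ × ℕ+ => (c.1 : ℕ) + c.2) h⟩

theorem mainTheorem2 (w : Equiv.Perm ℕ+) (hw : {i : ℕ+ | w i ≠ i}.Finite) :
    (∀ D D' : RCGraph w, Relation.EqvGen SimpleLadderMove D D') ↔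
      ¬ ContainsPattern perm1432 w := by
  constructor
  · intro h hpat
    obtain ⟨n, hn⟩ := exists_fixesAbove hw
    obtain ⟨D, D', hD, hD', k, hk⟩ := hasDistinctAdjacentSubwords n w hn hpat
    exact hk (adjacentSubword_eq_of_eqvGen (h ⟨D, hD⟩ ⟨D', hD'⟩) k)
  · rintro hpat ⟨D, hD⟩ ⟨D', hD'⟩
    obtain ⟨N, hN⟩ := exists_cellsBelow D
    obtain ⟨N', hN'⟩ := exists_cellsBelow D'
    exact (linked_of_not_containsPattern (max N N') w hpat D D' hD hD'
      (fun i j h => (hN i j h).trans (le_max_left _ _))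
      (fun i j h => (hN' i j h).trans (le_max_right _ _))).2.2
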